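/- **Theorem.** Let $f:\mathbb{R}^m\times\mathbb{R}^n\to\mathbb{R}$ be $L$-Lipschitz (jointly, for the Euclidean norm, $L>0$), let $f(\cdot,\mathbf y)$ be $\rho$-weakly convex for every $\mathbf y$ (that is, $f(\cdot,\mathbf y)+\frac{\rho}{2}\|\cdot\|^2$ is convex, $\rho>0$), and let $f(\mathbf x,\cdot)$ be concave for every $\mathbf x$. Let $\mathcal Y\subseteq\mathbb{R}^n$ be closed, convex and bounded, of diameter at most $D$ (with $D>0$). Put $\Phi(\mathbf x)=\max_{\mathbf y\in\mathcal Y}f(\mathbf x,\mathbf y)$ and assume that $\Phi$ is bounded below. Let $\mathbf x_0\in\mathbb{R}^m$, $\mathbf y_0\in\mathcal Y$, $\Delta_\Phi=\Phi(\mathbf x_0)-\inf_{\mathbf x}\Phi(\mathbf x)$ and $\epsilon>0$. Let $\Phi_{1/2\rho}(\mathbf x)=\min_{\mathbf w}\{\Phi(\mathbf w)+\rho\|\mathbf w-\mathbf x\|^2\}$ be the Moreau envelope; a point $\mathbf x$ is $\epsilon$-stationary if $\Phi_{1/2\rho}$ is differentiable at $\mathbf x$ and $\|\nabla\Phi_{1/2\rho}(\mathbf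 x)\|\le\epsilon$. Let $\partial f$ denote the Clarke subdifferential of $f$ on $\mathbb{R}^m\times\mathbb{R}^n$ and $\mathcal P_{\mathcal Y}$ the orthogonal projection onto $\mathcal Y$. There is an absolute constant $C>0$, independent of all the data above and below, such that the following hold. 1. (TTGDA.) Let $$\eta_{\mathbf x}=\min\Big\{\tfrac{\epsilon^2}{48\rho L^2},\tfrac{\epsilon^6}{65536\rho^3L^4D^2}\Big\},\qquad \eta_{\mathbf y}=\tfrac{\epsilon^2}{16\rho L^2}.$$ There is an integer $N\ge 0$ with $$N\le C\,\tfrac{\rho L^2\Delta_\Phi}{\epsilon^4}\max\Big\{1,\tfrac{\rho^2L^2D^2}{\epsilon^4}\Big\}$$ such that for every $T\ge N$ and all iterates $\mathbf x_{t+1}=\mathbf x_t-\eta_{\mathbf x}\mathbf g_{\mathbf x}^t$, $\mathbf y_{t+1}=\mathcal P_{\mathcal Y}(\mathbf y_t+\eta_{\mathbf y}\mathbf g_{\mathbf y}^t)$ with $(\mathbf g_{\mathbf x}^t,\mathbf g_{\mathbf y}^t)\in\partial f(\mathbf x_t,\mathbf y_t)$, $0\le t<T$ (a run that uses $T$ gradient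 evaluations), $\Phi_{1/2\rho}$ is differentiable at all the $\mathbf x_t$, $0\le t\le T$, the point $\hat{\mathbf x}$ drawn uniformly from $\{\mathbf x_t\}_{t=0}^T$ satisfies $\mathbb E\|\nabla\Phi_{1/2\rho}(\hat{\mathbf x})\|^2\le\epsilon^2$, and at least one of $\mathbf x_0,\dots,\mathbf x_T$ is $\epsilon$-stationary. 2. (TTSGDA with batch size $M=1$.) Let $\sigma\ge0$ and let $G(\mathbf x,\mathbf y,\xi)\in\mathbb{R}^m\times\mathbb{R}^n$, with $\xi\sim\nu$, be a (jointly measurable, square-integrable) stochastic oracle such that, for all $\mathbf x\in\mathbb{R}^m$ and $\mathbf y\in\mathcal Y$, $\mathbb E\,G(\mathbf x,\mathbf y,\xi)\in\partial f(\mathbf x,\mathbf y)$ and $\mathbb E\|G(\mathbf x,\mathbf y,\xi)-\mathbb E\,G(\mathbf x,\mathbf y,\xi)\|^2\le\sigma^2$. Let $$\eta_{\mathbf x}=\min\Big\{\tfrac{\epsilon^2}{48\rho(L^2+\sigma^2)},\tfrac{\epsilon^6}{131072\rho^3(L^2+\sigma^2)^2D^2}\Big\},\qquad \eta_{\mathbf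 y}=\tfrac{\epsilon^2}{32\rho(L^2+\sigma^2)}.$$ There is an integer $N\ge 0$ with $$N\le C\,\tfrac{\rho(L^2+\sigma^2)\Delta_\Phi}{\epsilon^4}\max\Big\{1,\tfrac{\rho^2(L^2+\sigma^2)D^2}{\epsilon^4}\Big\},$$ depending only on $f,\mathcal Y,L,\rho,D,\epsilon,\sigma$ and the starting point, such that for every $T\ge N$, every such oracle and i.i.d. samples $\xi^0,\xi^1,\dots\sim\nu$, the iterates $\mathbf x_{t+1}=\mathbf x_t-\eta_{\mathbf x}G_{\mathbf x}(\mathbf x_t,\mathbf y_t,\xi^t)$, $\mathbf y_{t+1}=\mathcal P_{\mathcal Y}(\mathbf y_t+\eta_{\mathbf y}G_{\mathbf y}(\mathbf x_t,\mathbf y_t,\xi^t))$, $0\le t<T$ (a run that uses $T$ stochastic gradient evaluations), have the property that $\Phi_{1/2\rho}$ is differentiable at all the $\mathbf x_t$, $0\le t\le T$, and that the point $\hat{\mathbf x}$ drawn uniformly, independently of the samples, from $\{\mathbf x_t\}_{t=0}^T$ satisfies $\mathbb E\|\nabla\Phi_{1/2\rho}(\hat{\mathbf x})\|^2\le\epsilon^2$.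 -/

import Mathlib

open MeasureTheory ProbabilityTheory Filter Topology Set
open scoped NNReal

noncomputable section

namespace Minimax

section Analysis

variable {V : Type*} [NormedAddCommGroup V] [InnerProductSpace ℝ V]

/-- `h` is `ρ`-weakly convex: `h + (ρ/2)‖·‖²` is convex. -/
def WeaklyConvex (ρ : ℝ) (h : V → ℝ) : Prop :=
  ConvexOn ℝ univ fun x => h x + ρ / 2 * ‖x‖ ^ 2

/-- Clarke's generalized directional derivative
`h°(z; v) = limsup_{z' → z, t ↓ 0} (h (z' + t v) - h z') / t`, as an extended real. -/
def clarkeDeriv (h : V → ℝ) (z v : V) : EReal :=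
  limsup (fun p : V × ℝ => (((h (p.1 + p.2 • v) - h p.1) / p.2 : ℝ) : EReal))
    (𝓝 z ×ˢ 𝓝[>] (0 : ℝ))

/-- The Clarke subdifferential `∂h(z) = {g : ⟪g, v⟫ ≤ h°(z; v) for all v}`. -/
def clarkeSubdifferential (h : V → ℝ) (z : V) : Set V :=
  {g | ∀ v, ((inner ℝ g v : ℝ) : EReal) ≤ clarkeDeriv h z v}

/-- The Moreau envelope `h_lam(x) = min_w h(w) + ‖w - x‖² / (2 lam)`. -/
def moreauEnvelope (h : V → ℝ) (lam : ℝ) (x : V) : ℝ :=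
  ⨅ w, (h w + 1 / (2 * lam) * ‖w - x‖ ^ 2)

/-- `x` is an `ε`-stationary point of the `ρ`-weakly convex function `h`: the Moreau envelope
`h_{1/(2ρ)}` has a gradient of norm at most `ε` at `x`. -/
def IsEpsStationary [CompleteSpace V] (h : V → ℝ) (ρ ε : ℝ) (x : V) : Prop :=
  DifferentiableAt ℝ (moreauEnvelope h (1 / (2 * ρ))) x ∧
    ‖gradient (moreauEnvelope h (1 / (2 * ρ))) x‖ ≤ ε

/-- The random point `X` is `ε`-stationary in expectation: `E ‖∇h_{1/(2ρ)}(X)‖² ≤ ε²`. -/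
def IsEpsStationaryInMean [CompleteSpace V] {S : Type*} [MeasurableSpace S] (P : Measure S)
    (h : V → ℝ) (ρ ε : ℝ) (X : S → V) : Prop :=
  (∀ s, DifferentiableAt ℝ (moreauEnvelope h (1 / (2 * ρ))) (X s)) ∧
    Integrable (fun s => ‖gradient (moreauEnvelope h (1 / (2 * ρ))) (X s)‖ ^ 2) P ∧
    ∫ s, ‖gradient (moreauEnvelope h (1 / (2 * ρ))) (X s)‖ ^ 2 ∂P ≤ ε ^ 2

/-- The orthogonal projection of `z` onto `Y`: a point of `Y` nearest to `z`. It exists and is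
unique when `Y` is closed, convex and non-empty, see `proj_spec` and `proj_unique`. -/
def proj (Y : Set V) (z : V) : V :=
  Classical.epsilon fun p => p ∈ Y ∧ ∀ q ∈ Y, ‖z - p‖ ≤ ‖z - q‖

theorem proj_spec [CompleteSpace V] {Y : Set V} (hne : Y.Nonempty) (hcl : IsClosed Y)
    (hco : Convex ℝ Y) (z : V) : proj Y z ∈ Y ∧ ∀ q ∈ Y, ‖z - proj Y z‖ ≤ ‖z - q‖ := by
  refine Classical.epsilon_spec (p := fun p => p ∈ Y ∧ ∀ q ∈ Y, ‖z - p‖ ≤ ‖z - q‖) ?_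
  obtain ⟨p, hp, h⟩ := exists_norm_eq_iInf_of_complete_convex hne hcl.isComplete hco z
  refine ⟨p, hp, fun q hq => ?_⟩
  rw [h]
  exact ciInf_le ⟨0, by rintro _ ⟨w, rfl⟩; exact norm_nonneg _⟩ (⟨q, hq⟩ : Y)

theorem proj_unique [CompleteSpace V] {Y : Set V} (hne : Y.Nonempty) (hcl : IsClosed Y)
    (hco : Convex ℝ Y) (z p : V) (hp : p ∈ Y) (hmin : ∀ q ∈ Y, ‖z - p‖ ≤ ‖z - q‖) :
    p = proj Y z := by
  obtain ⟨h1, h2⟩ := proj_spec hne hcl hco z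
  have key : ∀ a ∈ Y, (∀ q ∈ Y, ‖z - a‖ ≤ ‖z - q‖) → ∀ w ∈ Y, inner ℝ (z - a) (w - a) ≤ 0 := by
    intro a ha hm
    refine (norm_eq_iInf_iff_real_inner_le_zero hco ha).1 (le_antisymm ?_ ?_)
    · have : Nonempty Y := ⟨⟨a, ha⟩⟩
      exact le_ciInf fun w => hm w w.2
    · exact ciInf_le ⟨0, by rintro _ ⟨w, rfl⟩; exact norm_nonneg _⟩ (⟨a, ha⟩ : Y)
  have e1 := key p hp hmin _ h1
  have e2 := key _ h1 h2 p hp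
  have e3 : inner ℝ (p - proj Y z) (p - proj Y z) ≤ (0 : ℝ) := by
    have : inner ℝ (p - proj Y z) (p - proj Y z)
        = inner ℝ (z - p) (proj Y z - p) + inner ℝ (z - proj Y z) (p - proj Y z) := by
      rw [← neg_sub p (proj Y z), inner_neg_right, ← sub_eq_neg_add, ← inner_sub_left]
      congr 1
      abel
    linarith
  exact sub_eq_zero.1 (inner_self_eq_zero.1 (le_antisymm e3 real_inner_self_nonneg))

end Analysis

section Problem

variable {E F : Type*} [NormedAddCommGroup E] [InnerProductSpace ℝ E]
  [NormedAddCommGroup F] [InnerProductSpace ℝ F]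

/-- `f` as a function on the Euclidean product space. -/
def joint (f : E → F → ℝ) : WithLp 2 (E × F) → ℝ := fun p => f p.fst p.snd

/-- `Φ(x) = max_{y ∈ Y} f(x, y)`. -/
def primal (f : E → F → ℝ) (Y : Set F) (x : E) : ℝ := ⨆ y : Y, f x y

/-- The joint Clarke subdifferential `∂f(x, y)`. -/
def subdiff (f : E → F → ℝ) (x : E) (y : F) : Set (WithLp 2 (E × F)) :=
  clarkeSubdifferential (joint f) (WithLp.toLp 2 (x, y))

/-- The problem class: `f` is `L`-Lipschitz on the Euclidean product, `ρ`-weakly convex in `x` and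
concave in `y`; `Y` is closed, convex and bounded with diameter at most `D`. -/
structure IsNonconvexConcave (f : E → F → ℝ) (Y : Set F) (L : ℝ≥0) (ρ D : ℝ) : Prop where
  lipschitz : LipschitzWith L (joint f)
  weaklyConvex : ∀ y, WeaklyConvex ρ fun x => f x y
  concave : ∀ x, ConcaveOn ℝ univ (f x)
  closed : IsClosed Y
  convex : Convex ℝ Y
  bounded : Bornology.IsBounded Y
  diam_le : Metric.diam Y ≤ D

/-- `Δ_Φ = Φ(x₀) - inf_x Φ(x)`. -/
def gap (f : E → F → ℝ) (Y : Set F) (x₀ : E) : ℝ := primal f Y x₀ - ⨅ x, primal f Y x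

/-- `(x_t, y_t)`, `0 ≤ t ≤ T`, are iterates of `T` iterations of two-timescale (sub)gradient descent
ascent with step sizes `ηx t`, `ηy t`, started at `(x₀, y₀)`: every iteration evaluates one
(arbitrary) element of `∂f` at the current iterate. -/
structure IsTTGDARun (f : E → F → ℝ) (Y : Set F) (ηx ηy : ℕ → ℝ) (x₀ : E) (y₀ : F) (T : ℕ)
    (x : ℕ → E) (y : ℕ → F) : Prop where
  init_x : x 0 = x₀
  init_y : y 0 = y₀
  step : ∀ t < T, ∃ g ∈ subdiff f (x t) (y t),
    x (t + 1) = x t - ηx t • g.fst ∧ y (t + 1) = proj Y (y t + ηy t • g.snd)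

/-- Number of gradient evaluations in `T` iterations of the deterministic method. -/
def ttgdaEvals (T : ℕ) : ℕ := T

/-- The index drawn uniformly from `{0, …, T}` that selects the returned iterate. -/
def uniformIndex (T : ℕ) : Measure (Fin (T + 1)) := (PMF.uniformOfFintype (Fin (T + 1))).toMeasure

/-- A stochastic gradient oracle `G(x, y, ξ)`, `ξ ∼ ν`, that is unbiased, `E G(x, y, ξ) ∈ ∂f(x, y)`,
with variance bounded by `σ²`. -/
structure IsOracle [MeasurableSpace E] [MeasurableSpace F] {Ξ : Type*} [MeasurableSpace Ξ]
    (f : E → F → ℝ) (Y : Set F) (ν : Measure Ξ) (σ : ℝ) (G : E → F → Ξ → WithLp 2 (E × F)) :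
    Prop where
  measurable : Measurable fun p : (E × F) × Ξ => G p.1.1 p.1.2 p.2
  memLp : ∀ x, ∀ y ∈ Y, MemLp (G x y) 2 ν
  unbiased : ∀ x, ∀ y ∈ Y, (∫ s, G x y s ∂ν) ∈ subdiff f x y
  variance_le : ∀ x, ∀ y ∈ Y, ∫ s, ‖G x y s - ∫ s', G x y s' ∂ν‖ ^ 2 ∂ν ≤ σ ^ 2

/-- The mini-batch average `(1/M) ∑ᵢ G(x, y, ξᵢ)`. -/
def miniBatch {Ξ : Type*} {M : ℕ} (G : E → F → Ξ → WithLp 2 (E × F)) (ξ : Fin M → Ξ) (x : E)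
    (y : F) : WithLp 2 (E × F) :=
  (1 / (M : ℝ)) • ∑ i, G x y (ξ i)

/-- The iterates `(x_t, y_t)` of two-timescale stochastic gradient descent ascent with batch size
`M`, for a given sequence of samples `ξ t i`. -/
def ttsgda {Ξ : Type*} {M : ℕ} (Y : Set F) (ηx ηy : ℕ → ℝ) (G : E → F → Ξ → WithLp 2 (E × F))
    (x₀ : E) (y₀ : F) (ξ : ℕ → Fin M → Ξ) : ℕ → E × F
  | 0 => (x₀, y₀)
  | t + 1 =>
    let z := ttsgda Y ηx ηy G x₀ y₀ ξ t
    let g := miniBatch G (ξ t) z.1 z.2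
    (z.1 - ηx t • g.fst, proj Y (z.2 + ηy t • g.snd))

/-- Number of stochastic gradient evaluations in `T` iterations with batch size `M`. -/
def ttsgdaEvals (M T : ℕ) : ℕ := M * T

end Problem

end Minimax

end

open Minimax

set_option linter.unusedSectionVars false

namespace Minimax

/-! ### Clarke subgradients through bounds on difference quotients -/

section Clarke

variable {V : Type*} [NormedAddCommGroup V] [InnerProductSpace ℝ V]

/-! The Moreau envelope of $\Phi$ serves as Lyapunov function. With $p$ the proximal map, its
gradient at $x$ is $2\rho(x-p(x))$. Using $p(x_t)$ as a competitor in the envelope at $x_{t+1}$,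
together with the subgradient inequality in $x$ and the strong convexity of the proximal problem,
one step lowers the expected envelope by $2\rho^2\eta_x E\|p(x_t)-x_t\|^2$, up to the noise
$\rho\eta_x^2\Gamma^2$ and $2\rho\eta_x$ times the dual gap $E[\Phi(x_t)-f(x_t,y_t)]$
(`envelope_descent`); $\Gamma^2$ bounds the second moment of the search direction. Telescoping
(`sum_norm_prox_sub_sq_le`) reduces the claim to the average dual gap.

The dual gap is a regret. In a block of about $B$ steps $x_t$ moves in mean by at most about
$B\eta_x\Gamma$, so the projected ascent of $y_t$ can be compared with one near-maximizer fixed at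
the start of the block (`sum_gap_le`). A block costs $D^2/(2\eta_y)$ once, plus $\eta_y\Gamma^2/2$
and a drift of about $2\Gamma^2\eta_xB$ per step. Taking $B$ proportional to
$\rho^2\Gamma^2D^2/\epsilon^4$ makes the first cost, per step, of order $\epsilon^2/\rho$, and
$\eta_x$ is small enough for the drift to be of that order too (`sum_gradient_le`). Runs shorter
than one block are treated apart: the initial gap is then tiny and the iterates barely move.

Both methods are instances of `IsNoisyRun`, with $\Gamma^2=L^2$ and $\Gamma^2=L^2+\sigma^2$.
Conditional unbiasedness enters only through test functions of $(x_t,y_t,x_s)$, and for the oracle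
it follows from Fubini and the independence of the fresh sample (`integral_inner_of_indepFun`). -/

theorem inner_le_of_mem_clarkeSubdifferential {h : V → ℝ} {z g v : V}
    (hg : g ∈ clarkeSubdifferential h z) {φ : V × ℝ → ℝ} {c : ℝ}
    (hφ : Tendsto φ (𝓝 z ×ˢ 𝓝[>] (0 : ℝ)) (𝓝 c))
    (hle : ∀ᶠ p in 𝓝 z ×ˢ 𝓝[>] (0 : ℝ), (h (p.1 + p.2 • v) - h p.1) / p.2 ≤ φ p) :
    inner ℝ g v ≤ c := by
  have h1 : clarkeDeriv h z v ≤ (c : EReal) := by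
    have h2 : Tendsto (fun p => (φ p : EReal)) (𝓝 z ×ˢ 𝓝[>] (0 : ℝ)) (𝓝 (c : EReal)) :=
      (continuous_coe_real_ereal.tendsto c).comp hφ
    rw [← h2.limsup_eq]
    refine limsup_le_limsup ?_
    filter_upwards [hle] with p hp
    exact_mod_cast hp
  exact_mod_cast (hg v).trans h1

/-- Testing with the direction $g$ itself gives $\|g\|^2\le L\|g\|$. -/
theorem norm_le_of_mem_clarkeSubdifferential {h : V → ℝ} {z g : V} {L : ℝ≥0}
    (hL : LipschitzWith L h) (hg : g ∈ clarkeSubdifferential h z) : ‖g‖ ≤ L := by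
  have h1 : inner ℝ g g ≤ L * ‖g‖ := by
    refine inner_le_of_mem_clarkeSubdifferential hg (φ := fun _ => L * ‖g‖) tendsto_const_nhds ?_
    have h2 : ∀ᶠ p : V × ℝ in 𝓝 z ×ˢ 𝓝[>] (0 : ℝ), 0 < p.2 :=
      tendsto_snd.eventually (eventually_mem_nhdsWithin)
    filter_upwards [h2] with p hp
    rw [div_le_iff₀ hp]
    have h3 := hL.dist_le_mul (p.1 + p.2 • g) p.1
    rw [dist_eq_norm, dist_eq_norm, add_sub_cancel_left, norm_smul, Real.norm_eq_abs,
      Real.norm_eq_abs, abs_of_pos hp] at h3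
    linarith [le_abs_self (h (p.1 + p.2 • g) - h p.1)]
  rw [real_inner_self_eq_norm_sq] at h1
  by_contra hlt
  push Not at hlt
  have : 0 < ‖g‖ := lt_of_le_of_lt L.2 hlt
  nlinarith

theorem norm_add_smul_sub_sq (a b : V) (t : ℝ) :
    ‖a + t • (b - a)‖ ^ 2 = (1 - t) * ‖a‖ ^ 2 + t * ‖b‖ ^ 2 - t * (1 - t) * ‖b - a‖ ^ 2 := by
  have h3 : (1 - t) • a + t • b = a + t • (b - a) := by module
  rw [← h3, norm_add_sq_real, norm_sub_sq_real, norm_smul, norm_smul, inner_smul_left,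
    inner_smul_right, real_inner_comm]
  simp only [mul_pow, Real.norm_eq_abs, sq_abs]
  simp
  ring

theorem WeaklyConvex.combo_le {ρ : ℝ} {h : V → ℝ} (hh : WeaklyConvex ρ h) (a b : V) {t : ℝ}
    (h0 : 0 ≤ t) (h1 : t ≤ 1) :
    h (a + t • (b - a)) ≤ (1 - t) * h a + t * h b + ρ / 2 * (t * (1 - t)) * ‖b - a‖ ^ 2 := by
  have h2 := hh.2 (mem_univ a) (mem_univ b) (sub_nonneg.2 h1) h0 (by ring)
  have h3 : (1 - t) • a + t • b = a + t • (b - a) := by module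
  simp only [smul_eq_mul] at h2
  rw [h3, norm_add_smul_sub_sq] at h2
  linarith

end Clarke

/-! ### Partial subgradient inequalities from a joint Clarke subgradient -/

section Subgradients

variable {E F : Type*} [NormedAddCommGroup E] [InnerProductSpace ℝ E]
  [NormedAddCommGroup F] [InnerProductSpace ℝ F] {f : E → F → ℝ} {L : ℝ≥0}

theorem abs_sub_le_fst (hf : LipschitzWith L (joint f)) (x x' : E) (y : F) :
    |f x y - f x' y| ≤ L * ‖x - x'‖ := by
  have h := hf.dist_le_mul (WithLp.toLp 2 (x, y)) (WithLp.toLp 2 (x', y))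
  rw [WithLp.prod_dist_eq_of_L2] at h
  simpa [joint, Real.dist_eq, Real.sqrt_sq_eq_abs, dist_eq_norm] using h

theorem abs_sub_le_snd (hf : LipschitzWith L (joint f)) (x : E) (y y' : F) :
    |f x y - f x y'| ≤ L * ‖y - y'‖ := by
  have h := hf.dist_le_mul (WithLp.toLp 2 (x, y)) (WithLp.toLp 2 (x, y'))
  rw [WithLp.prod_dist_eq_of_L2] at h
  simpa [joint, Real.dist_eq, Real.sqrt_sq_eq_abs, dist_eq_norm] using h

/-- Weak convexity holds along $x$ for every $y$, hence at every base point near $(x,y)$. The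
quotient in the direction $(w-x,0)$ is thus dominated by a continuous function of base point and
step, whose limit is the right-hand side. No joint convexity or regularity is needed. -/
theorem inner_fst_le_of_mem_subdiff {ρ : ℝ} (hf : LipschitzWith L (joint f))
    (hw : ∀ y, WeaklyConvex ρ fun x => f x y) {x : E} {y : F} {g : WithLp 2 (E × F)}
    (hg : g ∈ subdiff f x y) (w : E) :
    inner ℝ g.fst (w - x) ≤ f w y - f x y + ρ / 2 * ‖w - x‖ ^ 2 := by
  set d : E := w - x with hd
  set v : WithLp 2 (E × F) := WithLp.toLp 2 (d, 0) with hv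
  have key : inner ℝ g v ≤ f w y - f x y + ρ / 2 * (1 - 0) * ‖d‖ ^ 2 := by
    refine inner_le_of_mem_clarkeSubdifferential hg
      (φ := fun p => joint f (p.1 + v) - joint f p.1 + ρ / 2 * (1 - p.2) * ‖d‖ ^ 2) ?_ ?_
    · have hc : Continuous fun p : WithLp 2 (E × F) × ℝ =>
          joint f (p.1 + v) - joint f p.1 + ρ / 2 * (1 - p.2) * ‖d‖ ^ 2 := by
        have := hf.continuous
        fun_prop
      have h1 := hc.tendsto (WithLp.toLp 2 (x, y), 0)
      rw [nhds_prod_eq] at h1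
      have h2 : joint f (WithLp.toLp 2 (x, y) + v) = f w y := by simp [joint, hv, hd]
      rw [h2] at h1
      exact h1.mono_left (Filter.prod_mono le_rfl nhdsWithin_le_nhds)
    · have h2 : ∀ᶠ p : WithLp 2 (E × F) × ℝ in 𝓝 (WithLp.toLp 2 (x, y)) ×ˢ 𝓝[>] (0 : ℝ),
          p.2 ∈ Ioc (0 : ℝ) 1 :=
        tendsto_snd.eventually (Ioc_mem_nhdsGT zero_lt_one)
      filter_upwards [h2] with p hp
      rw [div_le_iff₀ hp.1]
      have h3 := (hw p.1.snd).combo_le p.1.fst (p.1.fst + d) hp.1.le hp.2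
      have e1 : joint f (p.1 + p.2 • v) = f (p.1.fst + p.2 • d) p.1.snd := by simp [joint, hv]
      have e2 : joint f (p.1 + v) = f (p.1.fst + d) p.1.snd := by simp [joint, hv]
      have e3 : joint f p.1 = f p.1.fst p.1.snd := rfl
      rw [e1, e2, e3]
      simp only [add_sub_cancel_left] at h3
      linarith
  have h5 : inner ℝ g v = inner ℝ g.fst d := by
    rw [WithLp.prod_inner_apply]; simp [hv]
  rw [h5] at key
  linarith

/-- Here the direction is reversed: a nearby $y'$ is the combination of $y'-td$ and $y'+d$ with
weights $1/(1+t)$ and $t/(1+t)$, so concavity bounds the quotient along $-d$ by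
$f(x',y')-f(x',y'+d)$. -/
theorem sub_le_inner_snd_of_mem_subdiff (hf : LipschitzWith L (joint f))
    (hw : ∀ x, ConcaveOn ℝ univ (f x)) {x : E} {y : F} {g : WithLp 2 (E × F)}
    (hg : g ∈ subdiff f x y) (w : F) :
    f x w - f x y ≤ inner ℝ g.snd (w - y) := by
  set d : F := w - y with hd
  set v : WithLp 2 (E × F) := WithLp.toLp 2 (0, d) with hv
  have key : inner ℝ g (-v) ≤ f x y - f x w := by
    refine inner_le_of_mem_clarkeSubdifferential hg
      (φ := fun p => joint f p.1 - joint f (p.1 + v)) ?_ ?_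
    · have hc : Continuous fun p : WithLp 2 (E × F) × ℝ =>
          joint f p.1 - joint f (p.1 + v) := by
        have := hf.continuous
        fun_prop
      have h1 := hc.tendsto (WithLp.toLp 2 (x, y), 0)
      rw [nhds_prod_eq] at h1
      have h2 : joint f (WithLp.toLp 2 (x, y) + v) = f x w := by simp [joint, hv, hd]
      rw [h2] at h1
      exact h1.mono_left (Filter.prod_mono le_rfl nhdsWithin_le_nhds)
    · have h2 : ∀ᶠ p : WithLp 2 (E × F) × ℝ in 𝓝 (WithLp.toLp 2 (x, y)) ×ˢ 𝓝[>] (0 : ℝ),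
          p.2 ∈ Ioi (0 : ℝ) :=
        tendsto_snd.eventually eventually_mem_nhdsWithin
      filter_upwards [h2] with p hp
      have hp : 0 < p.2 := hp
      rw [div_le_iff₀ hp]
      have h1t : 0 < 1 + p.2 := by linarith
      have h3 := (hw p.1.fst).2 (mem_univ (p.1.snd - p.2 • d)) (mem_univ (p.1.snd + d))
        (by positivity : (0 : ℝ) ≤ 1 / (1 + p.2)) (by positivity : (0 : ℝ) ≤ p.2 / (1 + p.2))
        (by field_simp)
      have e0 : (1 / (1 + p.2)) • (p.1.snd - p.2 • d) + (p.2 / (1 + p.2)) • (p.1.snd + d)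
          = p.1.snd := by
        have : (1 / (1 + p.2)) • (p.1.snd - p.2 • d) + (p.2 / (1 + p.2)) • (p.1.snd + d)
          = ((1 / (1 + p.2)) * (1 + p.2)) • p.1.snd := by module
        rw [this, one_div_mul_cancel h1t.ne', one_smul]
      rw [e0] at h3
      have e1 : joint f (p.1 + p.2 • (-v)) = f p.1.fst (p.1.snd - p.2 • d) := by
        simp [joint, hv, sub_eq_add_neg]
      have e2 : joint f (p.1 + v) = f p.1.fst (p.1.snd + d) := by simp [joint, hv]
      have e3 : joint f p.1 = f p.1.fst p.1.snd := rfl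
      rw [e1, e2, e3]
      simp only [smul_eq_mul] at h3
      have h4 := mul_le_mul_of_nonneg_left h3 h1t.le
      have h5 : (1 + p.2) * (1 / (1 + p.2) * f p.1.fst (p.1.snd - p.2 • d)
          + p.2 / (1 + p.2) * f p.1.fst (p.1.snd + d))
          = f p.1.fst (p.1.snd - p.2 • d) + p.2 * f p.1.fst (p.1.snd + d) := by
        field_simp
      rw [h5] at h4
      linarith
  have h5 : inner ℝ g v = inner ℝ g.snd d := by
    rw [WithLp.prod_inner_apply]; simp [hv]
  rw [inner_neg_right, h5] at key
  linarith

end Subgradients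

/-! ### Regularity of the max function -/

section Primal

variable {E F : Type*} [NormedAddCommGroup E] [InnerProductSpace ℝ E]
  [NormedAddCommGroup F] [InnerProductSpace ℝ F] {f : E → F → ℝ} {L : ℝ≥0} {Y : Set F} {ρ D : ℝ}

theorem IsNonconvexConcave.norm_sub_le (hf : IsNonconvexConcave f Y L ρ D) {y y' : F} (hy : y ∈ Y)
    (hy' : y' ∈ Y) : ‖y - y'‖ ≤ D := by
  rw [← dist_eq_norm]
  exact (Metric.dist_le_diam_of_mem hf.bounded hy hy').trans hf.diam_le

theorem IsNonconvexConcave.bddAbove (hf : IsNonconvexConcave f Y L ρ D) (x : E) :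
    BddAbove (range fun y : Y => f x y) := by
  rcases Y.eq_empty_or_nonempty with h | ⟨y₀, h₀⟩
  · subst h
    simp
  · refine ⟨f x y₀ + L * D, ?_⟩
    rintro _ ⟨y, rfl⟩
    have h1 := (abs_le.1 (abs_sub_le_snd hf.lipschitz x y y₀)).2
    have h2 := mul_le_mul_of_nonneg_left (hf.norm_sub_le y.2 h₀) L.2
    simp only [NNReal.val_eq_coe] at h2
    dsimp only
    linarith

theorem IsNonconvexConcave.le_primal (hf : IsNonconvexConcave f Y L ρ D) (x : E) {y : F}
    (hy : y ∈ Y) : f x y ≤ primal f Y x :=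
  le_ciSup (hf.bddAbove x) (⟨y, hy⟩ : Y)

theorem primal_le (hne : Y.Nonempty) {x : E} {c : ℝ} (h : ∀ y ∈ Y, f x y ≤ c) :
    primal f Y x ≤ c := by
  have : Nonempty Y := hne.to_subtype
  exact ciSup_le fun y => h y y.2

theorem IsNonconvexConcave.primal_sub_le (hf : IsNonconvexConcave f Y L ρ D) (hne : Y.Nonempty)
    (x x' : E) : primal f Y x - primal f Y x' ≤ L * ‖x - x'‖ := by
  have : primal f Y x ≤ primal f Y x' + L * ‖x - x'‖ := by
    refine primal_le hne fun y hy => ?_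
    have h1 := (abs_le.1 (abs_sub_le_fst hf.lipschitz x x' y)).2
    linarith [hf.le_primal x' hy]
  linarith

theorem IsNonconvexConcave.lipschitz_primal (hf : IsNonconvexConcave f Y L ρ D)
    (hne : Y.Nonempty) : LipschitzWith L (primal f Y) := by
  refine LipschitzWith.of_dist_le_mul fun x x' => ?_
  rw [Real.dist_eq, dist_eq_norm, abs_le]
  have h1 := hf.primal_sub_le hne x x'
  have h2 := hf.primal_sub_le hne x' x
  rw [norm_sub_rev] at h2
  constructor <;> linarith

theorem IsNonconvexConcave.primal_sub_le_mul_diam (hf : IsNonconvexConcave f Y L ρ D) (x : E)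
    {y : F} (hy : y ∈ Y) : primal f Y x - f x y ≤ L * D := by
  have : primal f Y x ≤ f x y + L * D := by
    refine primal_le ⟨y, hy⟩ fun y' hy' => ?_
    have h1 := (abs_le.1 (abs_sub_le_snd hf.lipschitz x y' y)).2
    have h2 := mul_le_mul_of_nonneg_left (hf.norm_sub_le hy' hy) L.2
    simp only [NNReal.val_eq_coe] at h2
    linarith
  linarith

/-- The same quadratic convexifies every $f(\cdot,y)$, and suprema preserve convexity. -/
theorem IsNonconvexConcave.weaklyConvex_primal (hf : IsNonconvexConcave f Y L ρ D)
    (hne : Y.Nonempty) : WeaklyConvex ρ (primal f Y) := by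
  refine ⟨convex_univ, fun x _ x' _ a b ha hb hab => ?_⟩
  have : primal f Y (a • x + b • x') ≤ a • (primal f Y x + ρ / 2 * ‖x‖ ^ 2)
      + b • (primal f Y x' + ρ / 2 * ‖x'‖ ^ 2) - ρ / 2 * ‖a • x + b • x'‖ ^ 2 := by
    refine primal_le hne fun y hy => ?_
    have h1 := (hf.weaklyConvex y).2 (mem_univ x) (mem_univ x') ha hb hab
    simp only [smul_eq_mul] at h1 ⊢
    have h2 := mul_le_mul_of_nonneg_left (hf.le_primal x hy) ha
    have h3 := mul_le_mul_of_nonneg_left (hf.le_primal x' hy) hb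
    linarith
  simp only at this ⊢
  linarith

end Primal

/-! ### Orthogonal projection -/

section Proj

variable {V : Type*} [NormedAddCommGroup V] [InnerProductSpace ℝ V] [CompleteSpace V] {Y : Set V}

theorem inner_sub_proj_le (hne : Y.Nonempty) (hcl : IsClosed Y) (hco : Convex ℝ Y) (z : V) {q : V}
    (hq : q ∈ Y) : inner ℝ (z - proj Y z) (q - proj Y z) ≤ 0 := by
  obtain ⟨h1, h2⟩ := proj_spec hne hcl hco z
  refine (norm_eq_iInf_iff_real_inner_le_zero hco h1).1 (le_antisymm ?_ ?_) q hq
  · have : Nonempty Y := hne.to_subtype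
    exact le_ciInf fun w => h2 w w.2
  · exact ciInf_le ⟨0, by rintro _ ⟨w, rfl⟩; exact norm_nonneg _⟩ (⟨_, h1⟩ : Y)

theorem norm_proj_sub_le (hne : Y.Nonempty) (hcl : IsClosed Y) (hco : Convex ℝ Y) (z : V) {q : V}
    (hq : q ∈ Y) : ‖proj Y z - q‖ ≤ ‖z - q‖ := by
  have h1 := inner_sub_proj_le hne hcl hco z hq
  have h2 : ‖z - q‖ ^ 2 = ‖z - proj Y z‖ ^ 2 - 2 * inner ℝ (z - proj Y z) (q - proj Y z)
      + ‖proj Y z - q‖ ^ 2 := by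
    have : z - q = (z - proj Y z) - (q - proj Y z) := by abel
    rw [this, norm_sub_sq_real, norm_sub_rev q]
  refine (sq_le_sq₀ (norm_nonneg _) (norm_nonneg _)).1 ?_
  nlinarith [sq_nonneg ‖z - proj Y z‖]

/-- Serves only to make the iterates measurable. -/
theorem lipschitz_proj (hne : Y.Nonempty) (hcl : IsClosed Y) (hco : Convex ℝ Y) :
    LipschitzWith 1 (proj Y) := by
  refine LipschitzWith.of_dist_le_mul fun z z' => ?_
  have h1 := inner_sub_proj_le hne hcl hco z (proj_spec hne hcl hco z').1
  have h2 := inner_sub_proj_le hne hcl hco z' (proj_spec hne hcl hco z).1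
  set p := proj Y z
  set p' := proj Y z'
  have h3 : inner ℝ (p - p') (p - p') = inner ℝ (z - z') (p - p') + inner ℝ (z - p) (p' - p)
      + inner ℝ (z' - p') (p - p') := by
    simp only [inner_sub_left, inner_sub_right]
    ring
  have h4 := real_inner_le_norm (z - z') (p - p')
  rw [real_inner_self_eq_norm_sq] at h3
  rw [dist_eq_norm, dist_eq_norm, NNReal.coe_one, one_mul]
  by_contra hlt
  push Not at hlt
  have : 0 < ‖p - p'‖ := lt_of_le_of_lt (norm_nonneg _) hlt
  nlinarith

end Proj

/-! ### The proximal map and the gradient of the Moreau envelope -/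

section Moreau

variable {V : Type*} [NormedAddCommGroup V] [InnerProductSpace ℝ V] [FiniteDimensional ℝ V]
  {h : V → ℝ} {ρ : ℝ}

theorem moreauEnvelope_eq (h : V → ℝ) (ρ : ℝ) (x : V) :
    moreauEnvelope h (1 / (2 * ρ)) x = ⨅ w, (h w + ρ * ‖w - x‖ ^ 2) := by
  have : 1 / (2 * (1 / (2 * ρ))) = ρ := by
    rw [← mul_div_assoc, mul_one, one_div_div]
    rw [mul_div_assoc, mul_div_cancel₀]
    norm_num
  simp only [moreauEnvelope, this]

theorem exists_prox_point (hρ : 0 < ρ) (hc : Continuous h) (hb : BddBelow (range h)) (x : V) :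
    ∃ p, ∀ w, h p + ρ * ‖p - x‖ ^ 2 ≤ h w + ρ * ‖w - x‖ ^ 2 := by
  obtain ⟨b, hb⟩ := hb
  refine Continuous.exists_forall_le (f := fun w => h w + ρ * ‖w - x‖ ^ 2) (by fun_prop) ?_
  have h1 : Tendsto (fun w : V => ‖w - x‖) (cocompact V) atTop := by
    have := tendsto_dist_right_cocompact_atTop x
    simpa [dist_eq_norm] using this
  have h2 : Tendsto (fun w : V => b + ρ * ‖w - x‖ ^ 2) (cocompact V) atTop :=
    tendsto_atTop_add_const_left _ _
      (((tendsto_pow_atTop two_ne_zero).comp h1).const_mul_atTop hρ)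
  exact tendsto_atTop_mono (fun w => by
    have := hb (mem_range_self w)
    linarith) h2

/-- The penalty $\rho\|\cdot-x\|^2$ outweighs the concavity $\frac\rho2\|\cdot\|^2$ by
$\frac\rho2\|\cdot\|^2$. Compare $p$ with $p+t(w-p)$, divide by $t$ and let $t\downarrow0$. -/
theorem WeaklyConvex.prox_growth (hh : WeaklyConvex ρ h) {x p : V}
    (hp : ∀ w, h p + ρ * ‖p - x‖ ^ 2 ≤ h w + ρ * ‖w - x‖ ^ 2) (w : V) :
    h p + ρ * ‖p - x‖ ^ 2 + ρ / 2 * ‖w - p‖ ^ 2 ≤ h w + ρ * ‖w - x‖ ^ 2 := by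
  have key : ∀ t ∈ Ioo (0 : ℝ) 1, h p + ρ * ‖p - x‖ ^ 2 + ρ / 2 * (1 - t) * ‖w - p‖ ^ 2
      ≤ h w + ρ * ‖w - x‖ ^ 2 := by
    intro t ht
    have h1 := hh.combo_le p w ht.1.le ht.2.le
    have h2 := hp (p + t • (w - p))
    have e1 : p + t • (w - p) - x = (p - x) + t • ((w - x) - (p - x)) := by module
    have e2 : (w - x) - (p - x) = w - p := by abel
    rw [e1, norm_add_smul_sub_sq, e2] at h2
    have h5 : t * (h p + ρ * ‖p - x‖ ^ 2 + ρ / 2 * (1 - t) * ‖w - p‖ ^ 2)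
      ≤ t * (h w + ρ * ‖w - x‖ ^ 2) := by linarith
    exact le_of_mul_le_mul_left h5 ht.1
  have hlim : Tendsto (fun t : ℝ => h p + ρ * ‖p - x‖ ^ 2 + ρ / 2 * (1 - t) * ‖w - p‖ ^ 2)
      (𝓝[>] 0) (𝓝 (h p + ρ * ‖p - x‖ ^ 2 + ρ / 2 * (1 - 0) * ‖w - p‖ ^ 2)) :=
    ((by fun_prop : Continuous fun t : ℝ => h p + ρ * ‖p - x‖ ^ 2
      + ρ / 2 * (1 - t) * ‖w - p‖ ^ 2).tendsto 0).mono_left nhdsWithin_le_nhds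
  have := le_of_tendsto hlim (by
    filter_upwards [Ioo_mem_nhdsGT zero_lt_one] with t ht using key t ht)
  simpa using this

/-- The proximal map `p` of a weakly convex function, with the value and the gradient of the Moreau
envelope. -/
theorem WeaklyConvex.exists_prox (hρ : 0 < ρ) (hh : WeaklyConvex ρ h) (hc : Continuous h)
    (hb : BddBelow (range h)) :
    ∃ p : V → V, Continuous p ∧
      (∀ x, moreauEnvelope h (1 / (2 * ρ)) x = h (p x) + ρ * ‖p x - x‖ ^ 2) ∧
      (∀ x w, h (p x) + ρ * ‖p x - x‖ ^ 2 + ρ / 2 * ‖w - p x‖ ^ 2 ≤ h w + ρ * ‖w - x‖ ^ 2) ∧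
      ∀ x, HasGradientAt (moreauEnvelope h (1 / (2 * ρ))) ((2 * ρ) • (x - p x)) x := by
  choose p hp using exists_prox_point hρ hc hb
  have hval : ∀ x, moreauEnvelope h (1 / (2 * ρ)) x = h (p x) + ρ * ‖p x - x‖ ^ 2 := by
    intro x
    rw [moreauEnvelope_eq]
    refine le_antisymm (ciInf_le ⟨h (p x) + ρ * ‖p x - x‖ ^ 2, ?_⟩ (p x)) (le_ciInf (hp x))
    rintro _ ⟨w, rfl⟩
    exact hp x w
  have hgr := fun x w => hh.prox_growth (hp x) w
  have expand : ∀ a x x' : V, ‖a - x'‖ ^ 2 = ‖a - x‖ ^ 2 + 2 * inner ℝ (x - a) (x' - x)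
      + ‖x' - x‖ ^ 2 := by
    intro a x x'
    have : a - x' = -((x - a) + (x' - x)) := by abel
    rw [this, norm_neg, norm_add_sq_real, norm_sub_rev x a]
  -- Adding the growth inequalities at the two proximal points cancels $h$ and leaves
  -- $\|p(x')-p(x)\|^2\le2\langle p(x')-p(x),x'-x\rangle$.
  have hlip : ∀ x x', ‖p x' - p x‖ ≤ 2 * ‖x' - x‖ := by
    intro x x'
    have h1 := hgr x (p x')
    have h2 := hgr x' (p x)
    rw [expand (p x) x x', expand (p x') x x', norm_sub_rev (p x)] at h2
    have h3 : inner ℝ (x - p x) (x' - x) - inner ℝ (x - p x') (x' - x)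
        = inner ℝ (p x' - p x) (x' - x) := by
      rw [← inner_sub_left]
      congr 1
      abel
    have h4 := real_inner_le_norm (p x' - p x) (x' - x)
    have h5 : ρ * ‖p x' - p x‖ ^ 2 ≤ ρ * (2 * (‖p x' - p x‖ * ‖x' - x‖)) := by nlinarith
    have h6 := le_of_mul_le_mul_left h5 hρ
    by_contra hlt
    push Not at hlt
    have : 0 < ‖p x' - p x‖ := lt_of_le_of_lt (by positivity) hlt
    nlinarith
  have hcont : Continuous p := by
    refine (LipschitzWith.of_dist_le_mul (K := 2) fun x x' => ?_).continuous
    rw [dist_eq_norm, dist_eq_norm]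
    exact hlip x' x
  refine ⟨p, hcont, hval, hgr, fun x => ?_⟩
  rw [hasGradientAt_iff_isLittleO]
  -- The upper bound uses $p(x)$ as competitor at $x'$. The lower one uses $p(x')$ at $x$, and the
  -- Lipschitz bound on $p$ then replaces $p(x')$ by $p(x)$ in the linear term.
  have hbound : ∀ x', ‖moreauEnvelope h (1 / (2 * ρ)) x' - moreauEnvelope h (1 / (2 * ρ)) x
      - inner ℝ ((2 * ρ) • (x - p x)) (x' - x)‖ ≤ 4 * ρ * ‖x' - x‖ ^ 2 := by
    intro x'
    rw [hval, hval, inner_smul_left, Real.norm_eq_abs, abs_le]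
    simp only [conj_trivial]
    have h1 := hp x' (p x)
    have h2 := hp x (p x')
    rw [expand (p x) x x'] at h1
    have h3 := expand (p x') x x'
    have h4 : inner ℝ (x - p x) (x' - x) - inner ℝ (x - p x') (x' - x)
        = inner ℝ (p x' - p x) (x' - x) := by
      rw [← inner_sub_left]
      congr 1
      abel
    have h5 := real_inner_le_norm (p x' - p x) (x' - x)
    have h6 := mul_le_mul_of_nonneg_right (hlip x x') (norm_nonneg (x' - x))
    have h7 : inner ℝ (p x' - p x) (x' - x) ≤ 2 * ‖x' - x‖ ^ 2 := by nlinarith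
    have h8 := mul_le_mul_of_nonneg_left h7 hρ.le
    have h9 : 0 ≤ ρ * ‖x' - x‖ ^ 2 := by positivity
    rw [h3]
    constructor <;> nlinarith
  have hO : (fun x' => moreauEnvelope h (1 / (2 * ρ)) x' - moreauEnvelope h (1 / (2 * ρ)) x
      - inner ℝ ((2 * ρ) • (x - p x)) (x' - x)) =O[𝓝 x] fun x' => ‖x' - x‖ ^ 2 := by
    refine Asymptotics.IsBigO.of_bound (4 * ρ) (Eventually.of_forall fun x' => ?_)
    rw [Real.norm_of_nonneg (sq_nonneg ‖x' - x‖)]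
    exact hbound x'
  refine hO.trans_isLittleO ?_
  have h1 : (fun z : V => ‖z‖ ^ 2) =o[𝓝 0] fun z => z :=
    Asymptotics.isLittleO_norm_pow_id one_lt_two
  have h2 : Tendsto (fun x' : V => x' - x) (𝓝 x) (𝓝 0) := by
    simpa using (tendsto_id (x := 𝓝 x)).sub_const x
  exact h1.comp_tendsto h2

end Moreau

/-! ### Inequalities for a proximal map -/

section ProxMap

variable {V : Type*} [NormedAddCommGroup V] [InnerProductSpace ℝ V] [CompleteSpace V]

/-- `p` is the proximal map of the weakly convex function `h`. -/
structure IsProx (h : V → ℝ) (ρ : ℝ) (p : V → V) : Prop where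
  continuous : Continuous p
  value : ∀ x, moreauEnvelope h (1 / (2 * ρ)) x = h (p x) + ρ * ‖p x - x‖ ^ 2
  growth : ∀ x w, h (p x) + ρ * ‖p x - x‖ ^ 2 + ρ / 2 * ‖w - p x‖ ^ 2 ≤ h w + ρ * ‖w - x‖ ^ 2
  hasGradientAt : ∀ x, HasGradientAt (moreauEnvelope h (1 / (2 * ρ))) ((2 * ρ) • (x - p x)) x

variable {h : V → ℝ} {ρ : ℝ} {p : V → V}

theorem IsProx.norm_gradient_sq (hp : IsProx h ρ p) (x : V) :
    ‖gradient (moreauEnvelope h (1 / (2 * ρ))) x‖ ^ 2 = 4 * ρ ^ 2 * ‖p x - x‖ ^ 2 := by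
  rw [(hp.hasGradientAt x).gradient, norm_smul, mul_pow, norm_sub_rev, Real.norm_eq_abs, sq_abs]
  ring

theorem IsProx.differentiableAt (hp : IsProx h ρ p) (x : V) :
    DifferentiableAt ℝ (moreauEnvelope h (1 / (2 * ρ))) x :=
  (hp.hasGradientAt x).differentiableAt

theorem IsProx.continuous_envelope (hp : IsProx h ρ p) :
    Continuous (moreauEnvelope h (1 / (2 * ρ))) :=
  continuous_iff_continuousAt.2 fun x => (hp.differentiableAt x).continuousAt

theorem IsProx.envelope_le_add (hp : IsProx h ρ p) (hρ : 0 < ρ) (x w : V) :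
    moreauEnvelope h (1 / (2 * ρ)) x ≤ h w + ρ * ‖w - x‖ ^ 2 := by
  rw [hp.value]
  have := hp.growth x w
  have h2 : 0 ≤ ρ / 2 * ‖w - p x‖ ^ 2 := by positivity
  linarith

theorem IsProx.envelope_le (hp : IsProx h ρ p) (hρ : 0 < ρ) (x : V) :
    moreauEnvelope h (1 / (2 * ρ)) x ≤ h x := by
  simpa using hp.envelope_le_add hρ x x

/-- Growth at $w=x$. In the descent step weak convexity takes back $\rho/2$ of the $3\rho/2$,
leaving $\rho$. -/
theorem IsProx.add_le (hp : IsProx h ρ p) (x : V) :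
    h (p x) + 3 / 2 * ρ * ‖p x - x‖ ^ 2 ≤ h x := by
  have := hp.growth x x
  rw [sub_self, norm_zero, norm_sub_rev x] at this
  linarith

/-- Makes the envelope gradient at most $2L$ everywhere, which settles large $\epsilon$ and keeps
the test functions bounded. -/
theorem IsProx.mul_norm_sub_le (hp : IsProx h ρ p) {L : ℝ≥0} (hL : LipschitzWith L h)
    (hρ : 0 < ρ) (x : V) : ρ * ‖p x - x‖ ≤ L := by
  have h1 := hp.add_le x
  have h2 := hL.dist_le_mul x (p x)
  rw [Real.dist_eq, dist_eq_norm, norm_sub_rev] at h2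
  have h3 := le_abs_self (h x - h (p x))
  by_contra hlt
  push Not at hlt
  have : 0 < ‖p x - x‖ := by
    rcases (norm_nonneg (p x - x)).eq_or_lt with h0 | h0
    · rw [← h0, mul_zero] at hlt
      exact absurd hlt (not_lt.2 L.2)
    · exact h0
  nlinarith [mul_pos hρ this]

theorem IsProx.mul_norm_sub_sq_le (hp : IsProx h ρ p) (hρ : 0 < ρ) (hb : BddBelow (range h))
    (x : V) : ρ * ‖p x - x‖ ^ 2 ≤ h x - ⨅ w, h w := by
  have h1 := hp.add_le x
  have h2 := ciInf_le hb (p x)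
  have h3 : 0 ≤ ρ * ‖p x - x‖ ^ 2 := by positivity
  linarith

/-- Keeping the proximal term pays for the last iterate, from which no step is taken. -/
theorem IsProx.iInf_add_le (hp : IsProx h ρ p) (hb : BddBelow (range h)) (x : V) :
    (⨅ w, h w) + ρ * ‖p x - x‖ ^ 2 ≤ moreauEnvelope h (1 / (2 * ρ)) x := by
  rw [hp.value]
  have h2 := ciInf_le hb (p x)
  linarith

end ProxMap

theorem norm_fst_le {E F : Type*} [NormedAddCommGroup E] [NormedAddCommGroup F]
    (g : WithLp 2 (E × F)) : ‖g.fst‖ ≤ ‖g‖ :=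
  (sq_le_sq₀ (norm_nonneg _) (norm_nonneg _)).1 (by
    rw [WithLp.prod_norm_sq_eq_of_L2]
    nlinarith [sq_nonneg ‖g.snd‖])

theorem norm_snd_le {E F : Type*} [NormedAddCommGroup E] [NormedAddCommGroup F]
    (g : WithLp 2 (E × F)) : ‖g.snd‖ ≤ ‖g‖ :=
  (sq_le_sq₀ (norm_nonneg _) (norm_nonneg _)).1 (by
    rw [WithLp.prod_norm_sq_eq_of_L2]
    nlinarith [sq_nonneg ‖g.fst‖])

/-! ### Noisy runs: envelope descent and dual regret -/

section Run

variable {E F : Type*} [NormedAddCommGroup E] [InnerProductSpace ℝ E] [FiniteDimensional ℝ E]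
  [MeasurableSpace E] [BorelSpace E]
  [NormedAddCommGroup F] [InnerProductSpace ℝ F] [FiniteDimensional ℝ F]
  [MeasurableSpace F] [BorelSpace F]
  {Ω : Type*} [MeasurableSpace Ω]

/-- `T` steps of stochastic gradient descent ascent with search directions `g t` whose conditional
means `gm t` are Clarke subgradients and whose second moments are at most `Γ²`. -/
structure IsNoisyRun (μ : Measure Ω) (f : E → F → ℝ) (Y : Set F) (ηx ηy Γ : ℝ) (x₀ : E) (T : ℕ)
    (x : ℕ → Ω → E) (y : ℕ → Ω → F) (g gm : ℕ → Ω → WithLp 2 (E × F)) : Prop where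
  init_x : ∀ ω, x 0 ω = x₀
  measurable_x : ∀ t ≤ T, Measurable (x t)
  measurable_y : ∀ t ≤ T, Measurable (y t)
  measurable_mean : ∀ t < T, Measurable (gm t)
  memLp : ∀ t < T, MemLp (g t) 2 μ
  mem_y : ∀ t ≤ T, ∀ ω, y t ω ∈ Y
  step_x : ∀ t < T, ∀ ω, x (t + 1) ω = x t ω - ηx • (g t ω).fst
  step_y : ∀ t < T, ∀ ω, y (t + 1) ω = proj Y (y t ω + ηy • (g t ω).snd)
  mem_subdiff : ∀ t < T, ∀ ω, gm t ω ∈ subdiff f (x t ω) (y t ω)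
  sq_le : ∀ t < T, ∫ ω, ‖g t ω‖ ^ 2 ∂μ ≤ Γ ^ 2
  -- A weak form of conditional unbiasedness. The third slot $x_s$ is there because the dual
  -- comparator is a function of the iterate at the start of a block.
  unbiased : ∀ t < T, ∀ s ≤ t, ∀ h : E × F × E → WithLp 2 (E × F), Measurable h →
    (∃ c, ∀ a, ∀ b ∈ Y, ∀ a', ‖h (a, b, a')‖ ≤ c) →
    ∫ ω, inner ℝ (g t ω) (h (x t ω, y t ω, x s ω)) ∂μ
      = ∫ ω, inner ℝ (gm t ω) (h (x t ω, y t ω, x s ω)) ∂μ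

/-- A measurable selection of almost maximizers. -/
theorem exists_measurable_almost_argmax {f : E → F → ℝ} {Y : Set F} {L : ℝ≥0} {ρ D δ : ℝ}
    (hf : IsNonconvexConcave f Y L ρ D) (hne : Y.Nonempty) (hδ : 0 < δ) :
    ∃ v : E → F, Measurable v ∧ (∀ x, v x ∈ Y) ∧ ∀ x, primal f Y x - δ ≤ f x (v x) := by
  classical
  have : Nonempty Y := hne.to_subtype
  set d : ℕ → Y := TopologicalSpace.denseSeq Y
  have hfc : Continuous (Function.uncurry f) :=
    hf.lipschitz.continuous.comp (WithLp.prod_continuous_toLp 2 E F)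
  have hex : ∀ x, ∃ k, primal f Y x - δ < f x (d k) := by
    intro x
    obtain ⟨y, hy⟩ := exists_lt_of_lt_ciSup (show primal f Y x - δ < ⨆ y : Y, f x y by
      have : primal f Y x = ⨆ y : Y, f x y := rfl
      linarith)
    have ho : IsOpen {y : Y | primal f Y x - δ < f x y} :=
      isOpen_lt continuous_const (hfc.comp (by fun_prop : Continuous fun y : Y => (x, (y : F))))
    obtain ⟨k, hz⟩ := (TopologicalSpace.denseRange_denseSeq Y).exists_mem_open ho ⟨y, hy⟩
    exact ⟨k, hz⟩
  -- The first term of a dense sequence that comes within $\delta$ of the supremum; the slack makes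
  -- this a countable, hence measurable, choice.
  refine ⟨fun x => d (Nat.find (hex x)), ?_, fun x => (d _).2, fun x =>
    (Nat.find_spec (hex x)).le⟩
  have hm : Measurable fun x => Nat.find (hex x) := measurable_find hex fun k => by
    refine measurableSet_lt ?_ ?_
    · exact ((hf.lipschitz_primal hne).continuous.sub continuous_const).measurable
    · exact (hfc.comp (by fun_prop : Continuous fun x => (x, (d k : F)))).measurable
  exact (measurable_from_nat (f := fun k => (d k : F))).comp hm

variable {μ : Measure Ω} [IsProbabilityMeasure μ] {f : E → F → ℝ} {Y : Set F} {L : ℝ≥0}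
  {ρ D ηx ηy Γ : ℝ} {x₀ : E} {T : ℕ} {x : ℕ → Ω → E} {y : ℕ → Ω → F}
  {g gm : ℕ → Ω → WithLp 2 (E × F)}

namespace IsNoisyRun

theorem integrable_direction (hr : IsNoisyRun μ f Y ηx ηy Γ x₀ T x y g gm) {t : ℕ} (ht : t < T) :
    Integrable (g t) μ := (hr.memLp t ht).integrable one_le_two

theorem integrable_norm_sq (hr : IsNoisyRun μ f Y ηx ηy Γ x₀ T x y g gm) {t : ℕ} (ht : t < T) :
    Integrable (fun ω => ‖g t ω‖ ^ 2) μ := (hr.memLp t ht).integrable_norm_pow two_ne_zero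

theorem integrable_fst (hr : IsNoisyRun μ f Y ηx ηy Γ x₀ T x y g gm) {t : ℕ} (ht : t < T) :
    Integrable (fun ω => (g t ω).fst) μ := by
  refine (hr.integrable_direction ht).mono ?_ (ae_of_all _ fun ω => norm_fst_le _)
  exact (WithLp.prod_continuous_ofLp 2 E F).fst.comp_aestronglyMeasurable
    (hr.integrable_direction ht).1

theorem integrable_x (hr : IsNoisyRun μ f Y ηx ηy Γ x₀ T x y g gm) :
    ∀ t ≤ T, Integrable (x t) μ
  | 0, _ => by
    have : x 0 = fun _ => x₀ := funext hr.init_x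
    rw [this]
    exact integrable_const _
  | t + 1, ht => by
    have : x (t + 1) = fun ω => x t ω - ηx • (g t ω).fst := funext (hr.step_x t ht)
    rw [this]
    exact (hr.integrable_x t (Nat.le_of_succ_le ht)).sub ((hr.integrable_fst ht).smul ηx)

theorem integrable_comp_x (hr : IsNoisyRun μ f Y ηx ηy Γ x₀ T x y g gm) {t : ℕ} (ht : t ≤ T)
    {h : E → ℝ} (hc : Continuous h) {a b : ℝ} (hab : ∀ z, |h z| ≤ a + b * ‖z‖) :
    Integrable (fun ω => h (x t ω)) μ :=
  ((integrable_const a).add ((hr.integrable_x t ht).norm.const_mul b)).mono'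
    (hc.measurable.comp (hr.measurable_x t ht)).aestronglyMeasurable
    (ae_of_all _ fun _ => hab _)

theorem integrable_envelope (hr : IsNoisyRun μ f Y ηx ηy Γ x₀ T x y g gm)
    (hf : IsNonconvexConcave f Y L ρ D) (hne : Y.Nonempty) (hρ : 0 < ρ)
    (hb : BddBelow (range (primal f Y))) {p : E → E} (hp : IsProx (primal f Y) ρ p) {t : ℕ}
    (ht : t ≤ T) : Integrable (fun ω => moreauEnvelope (primal f Y) (1 / (2 * ρ)) (x t ω)) μ := by
  refine hr.integrable_comp_x ht hp.continuous_envelope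
    (a := |⨅ w, primal f Y w| + |primal f Y 0|) (b := L) fun z => ?_
  have h1 := hf.primal_sub_le hne z 0
  rw [sub_zero] at h1
  have h3 := neg_abs_le (⨅ w, primal f Y w)
  have h3' := abs_nonneg (⨅ w, primal f Y w)
  have h4 := le_abs_self (primal f Y 0)
  have h4' := abs_nonneg (primal f Y 0)
  have h5 := hp.envelope_le hρ z
  have h6 := hp.iInf_add_le hb z
  have h7 : 0 ≤ ρ * ‖p z - z‖ ^ 2 := by positivity
  have h8 : 0 ≤ L * ‖z‖ := by positivity
  exact abs_le.2 ⟨by linarith, by linarith⟩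

theorem integrable_gap (hr : IsNoisyRun μ f Y ηx ηy Γ x₀ T x y g gm)
    (hf : IsNonconvexConcave f Y L ρ D) (hne : Y.Nonempty) {t : ℕ} (ht : t ≤ T) :
    Integrable (fun ω => primal f Y (x t ω) - f (x t ω) (y t ω)) μ := by
  have hfc : Continuous (Function.uncurry f) :=
    hf.lipschitz.continuous.comp (WithLp.prod_continuous_toLp 2 E F)
  refine (integrable_const (L * D)).mono' ?_ (ae_of_all _ fun ω => ?_)
  · exact (((hf.lipschitz_primal hne).continuous.measurable.comp (hr.measurable_x t ht)).sub
      (hfc.measurable.comp ((hr.measurable_x t ht).prodMk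
        (hr.measurable_y t ht)))).aestronglyMeasurable
  · rw [Real.norm_of_nonneg (sub_nonneg.2 (hf.le_primal _ (hr.mem_y t ht ω)))]
    exact hf.primal_sub_le_mul_diam _ (hr.mem_y t ht ω)

theorem integrable_norm_prox_sub_sq (hr : IsNoisyRun μ f Y ηx ηy Γ x₀ T x y g gm)
    (hf : IsNonconvexConcave f Y L ρ D) (hne : Y.Nonempty) (hρ : 0 < ρ)
    {p : E → E} (hp : IsProx (primal f Y) ρ p) {t : ℕ} (ht : t ≤ T) :
    Integrable (fun ω => ‖p (x t ω) - x t ω‖ ^ 2) μ := by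
  have hpc := hp.continuous
  refine hr.integrable_comp_x ht (h := fun z => ‖p z - z‖ ^ 2) (by fun_prop)
    (a := (L / ρ) ^ 2) (b := 0) fun z => ?_
  rw [abs_of_nonneg (sq_nonneg _), zero_mul, add_zero]
  refine pow_le_pow_left₀ (norm_nonneg _) ?_ 2
  rw [le_div_iff₀ hρ, mul_comm]
  exact hp.mul_norm_sub_le (hf.lipschitz_primal hne) hρ z

theorem integrable_inner {u w : Ω → WithLp 2 (E × F)} (hu : Integrable u μ) (hw : Measurable w)
    {c : ℝ} (hc : ∀ ω, ‖w ω‖ ≤ c) : Integrable (fun ω => inner ℝ (u ω) (w ω)) μ := by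
  refine (hu.norm.mul_const c).mono' (hu.1.inner hw.aestronglyMeasurable) (ae_of_all _ fun ω => ?_)
  exact (norm_inner_le_norm _ _).trans (mul_le_mul_of_nonneg_left (hc ω) (norm_nonneg _))

theorem integrable_mean (hr : IsNoisyRun μ f Y ηx ηy Γ x₀ T x y g gm)
    (hf : IsNonconvexConcave f Y L ρ D) {t : ℕ} (ht : t < T) : Integrable (gm t) μ :=
  (integrable_const (L : ℝ)).mono' (hr.measurable_mean t ht).aestronglyMeasurable
    (ae_of_all _ fun ω => norm_le_of_mem_clarkeSubdifferential hf.lipschitz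
      (hr.mem_subdiff t ht ω))

/-- Integrate $a\le a^2/(2\Gamma)+\Gamma/2$. -/
theorem integral_norm_le (hr : IsNoisyRun μ f Y ηx ηy Γ x₀ T x y g gm) (hΓ : 0 < Γ) {t : ℕ}
    (ht : t < T) : ∫ ω, ‖g t ω‖ ∂μ ≤ Γ := by
  have h1 : ∫ ω, ‖g t ω‖ ∂μ ≤ ∫ ω, ((2 * Γ)⁻¹ * ‖g t ω‖ ^ 2 + Γ / 2) ∂μ := by
    refine integral_mono (hr.integrable_direction ht).norm
      (((hr.integrable_norm_sq ht).const_mul _).add (integrable_const _)) fun ω => ?_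
    have : (2 * Γ)⁻¹ * ‖g t ω‖ ^ 2 + Γ / 2 - ‖g t ω‖ = (2 * Γ)⁻¹ * (‖g t ω‖ - Γ) ^ 2 := by
      field_simp
      ring
    have h2 : 0 ≤ (2 * Γ)⁻¹ * (‖g t ω‖ - Γ) ^ 2 := by positivity
    dsimp only
    linarith
  rw [integral_add ((hr.integrable_norm_sq ht).const_mul _) (integrable_const _),
    integral_const_mul, integral_const] at h1
  have h3 := mul_le_mul_of_nonneg_left (hr.sq_le t ht) (by positivity : 0 ≤ (2 * Γ)⁻¹)
  have h4 : (2 * Γ)⁻¹ * Γ ^ 2 = Γ / 2 := by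
    field_simp
  simp at h1
  rw [h4] at h3
  simp at h3
  linarith

theorem integral_norm_sub_le (hr : IsNoisyRun μ f Y ηx ηy Γ x₀ T x y g gm) (hΓ : 0 < Γ)
    (hη : 0 ≤ ηx) (s : ℕ) : ∀ n, s + n ≤ T → ∫ ω, ‖x (s + n) ω - x s ω‖ ∂μ ≤ n * (ηx * Γ)
  | 0, _ => by simp
  | n + 1, h => by
    have hn : s + n < T := h
    have ih := hr.integral_norm_sub_le hΓ hη s n hn.le
    have hx : ∀ t ≤ T, Integrable (x t) μ := hr.integrable_x
    have i1 : Integrable (fun ω => ‖x (s + n) ω - x s ω‖) μ :=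
      ((hx _ hn.le).sub (hx s (by omega))).norm
    have i2 : Integrable (fun ω => ηx * ‖g (s + n) ω‖) μ :=
      (hr.integrable_direction hn).norm.const_mul _
    have h1 : ∫ ω, ‖x (s + (n + 1)) ω - x s ω‖ ∂μ
        ≤ ∫ ω, (‖x (s + n) ω - x s ω‖ + ηx * ‖g (s + n) ω‖) ∂μ := by
      refine integral_mono ((hx _ h).sub (hx s (by omega))).norm (i1.add i2) fun ω => ?_
      dsimp only
      rw [← add_assoc, hr.step_x _ hn, sub_right_comm]
      refine (norm_sub_le _ _).trans ?_
      rw [norm_smul, Real.norm_of_nonneg hη]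
      have := mul_le_mul_of_nonneg_left (norm_fst_le (g (s + n) ω)) hη
      linarith
    rw [integral_add i1 i2, integral_const_mul] at h1
    have h2 := mul_le_mul_of_nonneg_left (hr.integral_norm_le hΓ hn) hη
    push_cast
    linarith

/-- Expected decrease of the Moreau envelope in one step. -/
theorem envelope_descent (hr : IsNoisyRun μ f Y ηx ηy Γ x₀ T x y g gm)
    (hf : IsNonconvexConcave f Y L ρ D) (hne : Y.Nonempty) (hρ : 0 < ρ)
    (hb : BddBelow (range (primal f Y))) (hη : 0 ≤ ηx) {p : E → E}
    (hp : IsProx (primal f Y) ρ p) {t : ℕ} (ht : t < T) :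
    ∫ ω, moreauEnvelope (primal f Y) (1 / (2 * ρ)) (x (t + 1) ω) ∂μ
      ≤ ∫ ω, moreauEnvelope (primal f Y) (1 / (2 * ρ)) (x t ω) ∂μ
        + 2 * ρ * ηx * (∫ ω, (primal f Y (x t ω) - f (x t ω) (y t ω)) ∂μ
          - ρ * ∫ ω, ‖p (x t ω) - x t ω‖ ^ 2 ∂μ) + ρ * ηx ^ 2 * Γ ^ 2 := by
  have hpc := hp.continuous
  set H : E × F × E → WithLp 2 (E × F) := fun z => WithLp.toLp 2 (p z.1 - z.1, 0) with hH
  have hHm : Measurable H := ((WithLp.prod_continuous_toLp 2 E F).comp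
    (by fun_prop : Continuous fun z : E × F × E => (p z.1 - z.1, (0 : F)))).measurable
  have hHn : ∀ z, ‖H z‖ ≤ L / ρ := by
    intro z
    have : ‖H z‖ = ‖p z.1 - z.1‖ := by simp [hH]
    rw [this, le_div_iff₀ hρ, mul_comm]
    exact hp.mul_norm_sub_le (hf.lipschitz_primal hne) hρ _
  have hHc : Measurable fun ω => H (x t ω, y t ω, x t ω) :=
    hHm.comp ((hr.measurable_x t ht.le).prodMk
      ((hr.measurable_y t ht.le).prodMk (hr.measurable_x t ht.le)))
  have hHi : ∀ (u : WithLp 2 (E × F)) (z : E × F × E), inner ℝ u (H z)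
      = inner ℝ u.fst (p z.1 - z.1) := by
    intro u z
    rw [WithLp.prod_inner_apply]
    simp [hH]
  have i0 := hr.integrable_envelope hf hne hρ hb hp ht.le
  have i1 : Integrable (fun ω => inner ℝ (g t ω) (H (x t ω, y t ω, x t ω))) μ :=
    integrable_inner (hr.integrable_direction ht) hHc fun ω => hHn _
  have i2 : Integrable (fun ω => inner ℝ (gm t ω) (H (x t ω, y t ω, x t ω))) μ :=
    integrable_inner (hr.integrable_mean hf ht) hHc fun ω => hHn _
  have i3 := hr.integrable_norm_sq ht
  have i4 := hr.integrable_gap hf hne ht.le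
  have i5 := hr.integrable_norm_prox_sub_sq hf hne hρ hp ht.le
  have i6 : Integrable (fun ω => 2 * ρ * ηx * inner ℝ (g t ω) (H (x t ω, y t ω, x t ω))
      + ρ * ηx ^ 2 * ‖g t ω‖ ^ 2) μ := (i1.const_mul _).add (i3.const_mul _)
  have h1 : ∫ ω, moreauEnvelope (primal f Y) (1 / (2 * ρ)) (x (t + 1) ω) ∂μ
      ≤ ∫ ω, (moreauEnvelope (primal f Y) (1 / (2 * ρ)) (x t ω)
        + (2 * ρ * ηx * inner ℝ (g t ω) (H (x t ω, y t ω, x t ω))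
        + ρ * ηx ^ 2 * ‖g t ω‖ ^ 2)) ∂μ := by
    refine integral_mono (hr.integrable_envelope hf hne hρ hb hp ht)
      (i0.add i6) fun ω => ?_
    -- The old proximal point competes in the new envelope.
    have h2 := hp.envelope_le_add hρ (x (t + 1) ω) (p (x t ω))
    have h3 : p (x t ω) - x (t + 1) ω = (p (x t ω) - x t ω) + ηx • (g t ω).fst := by
      rw [hr.step_x t ht]
      abel
    rw [h3, norm_add_sq_real, inner_smul_right, norm_smul, mul_pow, Real.norm_eq_abs, sq_abs,
      real_inner_comm] at h2
    have h4 : ‖(g t ω).fst‖ ^ 2 ≤ ‖g t ω‖ ^ 2 :=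
      pow_le_pow_left₀ (norm_nonneg _) (norm_fst_le _) 2
    have h5 := mul_le_mul_of_nonneg_left h4 (by positivity : 0 ≤ ρ * ηx ^ 2)
    dsimp only
    rw [hHi, hp.value (x t ω)]
    dsimp only
    linarith
  rw [integral_add i0 i6,
    integral_add (i1.const_mul _) (i3.const_mul _), integral_const_mul, integral_const_mul,
    hr.unbiased t ht t le_rfl H hHm ⟨L / ρ, fun a b _ a' => hHn _⟩] at h1
  have h6 : ∫ ω, inner ℝ (gm t ω) (H (x t ω, y t ω, x t ω)) ∂μ
      ≤ ∫ ω, ((primal f Y (x t ω) - f (x t ω) (y t ω)) - ρ * ‖p (x t ω) - x t ω‖ ^ 2) ∂μ := by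
    refine integral_mono i2 (i4.sub (i5.const_mul ρ)) fun ω => ?_
    have h7 := inner_fst_le_of_mem_subdiff hf.lipschitz hf.weaklyConvex (hr.mem_subdiff t ht ω)
      (p (x t ω))
    have h8 := hp.add_le (x t ω)
    have h9 := hf.le_primal (p (x t ω)) (hr.mem_y t ht.le ω)
    dsimp only
    rw [hHi]
    dsimp only
    linarith
  rw [integral_sub i4 (i5.const_mul ρ), integral_const_mul] at h6
  have h7 := mul_le_mul_of_nonneg_left h6 (by positivity : 0 ≤ 2 * ρ * ηx)
  have h8 := mul_le_mul_of_nonneg_left (hr.sq_le t ht) (by positivity : 0 ≤ ρ * ηx ^ 2)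
  linarith

theorem sum_norm_prox_sub_sq_le (hr : IsNoisyRun μ f Y ηx ηy Γ x₀ T x y g gm)
    (hf : IsNonconvexConcave f Y L ρ D) (hne : Y.Nonempty) (hρ : 0 < ρ)
    (hb : BddBelow (range (primal f Y))) (hη : 0 ≤ ηx) (hη' : 2 * ρ * ηx ≤ 1) {p : E → E}
    (hp : IsProx (primal f Y) ρ p) :
    2 * ρ ^ 2 * ηx * ∑ t ∈ Finset.range (T + 1), ∫ ω, ‖p (x t ω) - x t ω‖ ^ 2 ∂μ
      ≤ gap f Y x₀ + 2 * ρ * ηx * ∑ t ∈ Finset.range T,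
        ∫ ω, (primal f Y (x t ω) - f (x t ω) (y t ω)) ∂μ + T * (ρ * ηx ^ 2 * Γ ^ 2) := by
  have key : ∀ n ≤ T, 2 * ρ ^ 2 * ηx * ∑ t ∈ Finset.range n, ∫ ω, ‖p (x t ω) - x t ω‖ ^ 2 ∂μ
      ≤ primal f Y x₀ - ∫ ω, moreauEnvelope (primal f Y) (1 / (2 * ρ)) (x n ω) ∂μ
        + 2 * ρ * ηx * ∑ t ∈ Finset.range n,
        ∫ ω, (primal f Y (x t ω) - f (x t ω) (y t ω)) ∂μ + n * (ρ * ηx ^ 2 * Γ ^ 2) := by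
    intro n
    induction n with
    | zero =>
      intro _
      simp only [hr.init_x]
      simp
      simpa using hp.envelope_le hρ x₀
    | succ n ih =>
      intro hn
      have h1 := ih (Nat.le_of_succ_le hn)
      have h2 := hr.envelope_descent hf hne hρ hb hη hp hn
      rw [Finset.sum_range_succ, Finset.sum_range_succ]
      push_cast
      linarith
  have h1 := key T le_rfl
  have i5 := hr.integrable_norm_prox_sub_sq hf hne hρ hp (le_refl T)
  have h2 : ∫ ω, ((⨅ w, primal f Y w) + ρ * ‖p (x T ω) - x T ω‖ ^ 2) ∂μ
      ≤ ∫ ω, moreauEnvelope (primal f Y) (1 / (2 * ρ)) (x T ω) ∂μ :=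
    integral_mono ((integrable_const _).add (i5.const_mul ρ))
      (hr.integrable_envelope hf hne hρ hb hp le_rfl) fun ω => hp.iInf_add_le hb _
  rw [integral_add (integrable_const _) (i5.const_mul ρ), integral_const, integral_const_mul] at h2
  simp only [probReal_univ, one_smul] at h2
  have h3 : 0 ≤ ∫ ω, ‖p (x T ω) - x T ω‖ ^ 2 ∂μ := integral_nonneg fun ω => sq_nonneg _
  -- The term $t=T$ has no descent step; since $2\rho\eta_x\le1$ it is covered by the proximal part
  -- of the last envelope value.
  have h4 := mul_le_mul_of_nonneg_right hη' (mul_nonneg hρ.le h3)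
  rw [Finset.sum_range_succ, gap]
  linarith

/-- Sum of the expected dual gaps over at most `B` consecutive steps. -/
theorem sum_gap_le (hr : IsNoisyRun μ f Y ηx ηy Γ x₀ T x y g gm)
    (hf : IsNonconvexConcave f Y L ρ D) (hne : Y.Nonempty) (hΓ : 0 < Γ) (hLΓ : L ≤ Γ)
    (hη : 0 ≤ ηx) (hηy : 0 < ηy) {b : ℝ} {s : ℕ} {n : ℕ} (hn : s + n ≤ T) (hnb : (n : ℝ) - 1 ≤ b) :
    ∑ i ∈ Finset.range n, ∫ ω, (primal f Y (x (s + i) ω) - f (x (s + i) ω) (y (s + i) ω)) ∂μ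
      ≤ D ^ 2 / (2 * ηy) + n * (ηy * Γ ^ 2 / 2 + 2 * Γ ^ 2 * ηx * b) := by
  have hD : ∀ q ∈ Y, ∀ q' ∈ Y, ‖q - q'‖ ^ 2 ≤ D ^ 2 := fun q hq q' hq' =>
    pow_le_pow_left₀ (norm_nonneg _) (hf.norm_sub_le hq hq') 2
  -- Projected ascent telescopes the squared distance to the comparator $v(x_s)$, which stays fixed
  -- over the block.
  have key : ∀ δ > 0, ∀ v : E → F, Measurable v → (∀ z, v z ∈ Y) →
      (∀ z, primal f Y z - δ ≤ f z (v z)) → ∀ k ≤ n,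
      2 * ηy * ∑ i ∈ Finset.range k,
        ∫ ω, (primal f Y (x (s + i) ω) - f (x (s + i) ω) (y (s + i) ω)) ∂μ
        + ∫ ω, ‖y (s + k) ω - v (x s ω)‖ ^ 2 ∂μ
      ≤ ∫ ω, ‖y s ω - v (x s ω)‖ ^ 2 ∂μ
        + k * (ηy ^ 2 * Γ ^ 2 + 2 * ηy * (δ + 2 * Γ ^ 2 * ηx * b)) := by
    intro δ hδ v hvm hvY hv k
    induction k with
    | zero => simp
    | succ k ih =>
      intro hk
      have ih := ih (Nat.le_of_succ_le hk)
      set t := s + k with htk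
      have ht : t < T := by omega
      have hs : s ≤ T := by omega
      have iy : ∀ t ≤ T, Integrable (fun ω => ‖y t ω - v (x s ω)‖ ^ 2) μ := by
        intro t ht
        refine (integrable_const (D ^ 2)).mono' ?_ (ae_of_all _ fun ω => ?_)
        · exact (((hr.measurable_y t ht).sub (hvm.comp (hr.measurable_x s hs))).norm.pow_const
            2).aestronglyMeasurable
        · rw [Real.norm_of_nonneg (sq_nonneg _)]
          exact hD _ (hr.mem_y t ht ω) _ (hvY _)
      set H : E × F × E → WithLp 2 (E × F) := fun z => WithLp.toLp 2 (0, v z.2.2 - z.2.1) with hH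
      have hHm : Measurable H := (WithLp.prod_continuous_toLp 2 E F).measurable.comp
        (measurable_const.prodMk ((hvm.comp measurable_snd.snd).sub measurable_snd.fst))
      have hHn : ∀ a, ∀ b ∈ Y, ∀ a', ‖H (a, b, a')‖ ≤ D := by
        intro a b hb a'
        have : ‖H (a, b, a')‖ = ‖v a' - b‖ := by simp [hH]
        rw [this]
        exact hf.norm_sub_le (hvY _) hb
      have hHc : Measurable fun ω => H (x t ω, y t ω, x s ω) :=
        hHm.comp ((hr.measurable_x t ht.le).prodMk
          ((hr.measurable_y t ht.le).prodMk (hr.measurable_x s hs)))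
      have hHi : ∀ (u : WithLp 2 (E × F)) (z : E × F × E), inner ℝ u (H z)
          = inner ℝ u.snd (v z.2.2 - z.2.1) := by
        intro u z
        rw [WithLp.prod_inner_apply]
        simp [hH]
      have i1 : Integrable (fun ω => inner ℝ (g t ω) (H (x t ω, y t ω, x s ω))) μ :=
        integrable_inner (hr.integrable_direction ht) hHc fun ω =>
          hHn _ _ (hr.mem_y t ht.le ω) _
      have i2 : Integrable (fun ω => inner ℝ (gm t ω) (H (x t ω, y t ω, x s ω))) μ :=
        integrable_inner (hr.integrable_mean hf ht) hHc fun ω => hHn _ _ (hr.mem_y t ht.le ω) _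
      have i3 := hr.integrable_norm_sq ht
      have i4 := hr.integrable_gap hf hne ht.le
      have i5 : Integrable (fun ω => ‖x t ω - x s ω‖) μ :=
        ((hr.integrable_x t ht.le).sub (hr.integrable_x s hs)).norm
      have i6 : Integrable (fun ω => ηy ^ 2 * ‖g t ω‖ ^ 2
          - 2 * ηy * inner ℝ (g t ω) (H (x t ω, y t ω, x s ω))) μ :=
        (i3.const_mul _).sub (i1.const_mul _)
      have i7 : Integrable (fun ω => δ + 2 * L * ‖x t ω - x s ω‖) μ :=
        (integrable_const _).add (i5.const_mul _)
      have h1 : ∫ ω, ‖y (t + 1) ω - v (x s ω)‖ ^ 2 ∂μ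
          ≤ ∫ ω, (‖y t ω - v (x s ω)‖ ^ 2 + (ηy ^ 2 * ‖g t ω‖ ^ 2
            - 2 * ηy * inner ℝ (g t ω) (H (x t ω, y t ω, x s ω)))) ∂μ := by
        refine integral_mono (iy _ ht) ((iy t ht.le).add i6)
          fun ω => ?_
        have h2 := norm_proj_sub_le hne hf.closed hf.convex (y t ω + ηy • (g t ω).snd)
          (hvY (x s ω))
        rw [← hr.step_y t ht] at h2
        have h3 := pow_le_pow_left₀ (norm_nonneg _) h2 2
        have h4 : y t ω + ηy • (g t ω).snd - v (x s ω)
            = ηy • (g t ω).snd - (v (x s ω) - y t ω) := by abel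
        rw [h4, norm_sub_sq_real (ηy • _), inner_smul_left, norm_smul, mul_pow, Real.norm_eq_abs, sq_abs,
          norm_sub_rev (v _)] at h3
        have h5 : ‖(g t ω).snd‖ ^ 2 ≤ ‖g t ω‖ ^ 2 :=
          pow_le_pow_left₀ (norm_nonneg _) (norm_snd_le _) 2
        have h6 := mul_le_mul_of_nonneg_left h5 (by positivity : 0 ≤ ηy ^ 2)
        dsimp only
        rw [hHi]
        simp only [conj_trivial] at h3
        dsimp only
        linarith
      rw [integral_add (iy t ht.le) i6,
        integral_sub (i3.const_mul _) (i1.const_mul _), integral_const_mul, integral_const_mul,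
        hr.unbiased t ht s (by omega) H hHm ⟨D, hHn⟩] at h1
      have h6 : ∫ ω, ((primal f Y (x t ω) - f (x t ω) (y t ω)) - (δ + 2 * L * ‖x t ω - x s ω‖)) ∂μ
          ≤ ∫ ω, inner ℝ (gm t ω) (H (x t ω, y t ω, x s ω)) ∂μ := by
        refine integral_mono (i4.sub i7) i2 fun ω => ?_
        have h7 := sub_le_inner_snd_of_mem_subdiff hf.lipschitz hf.concave
          (hr.mem_subdiff t ht ω) (v (x s ω))
        -- Passing between $x_t$ and $x_s$ costs $L\|x_t-x_s\|$ twice: once in $\Phi$, once in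
        -- $f(\cdot,v(x_s))$.
        have h8 := hf.primal_sub_le hne (x t ω) (x s ω)
        have h9 := (abs_le.1 (abs_sub_le_fst hf.lipschitz (x t ω) (x s ω) (v (x s ω)))).1
        have h10 := hv (x s ω)
        dsimp only
        rw [hHi]
        dsimp only
        linarith
      rw [integral_sub i4 i7,
        integral_add (integrable_const _) (i5.const_mul _), integral_const_mul,
        integral_const] at h6
      simp only [probReal_univ, one_smul] at h6
      have h7 := hr.integral_norm_sub_le hΓ hη s k ht.le
      -- The last step of the block has $k=n-1$, so $b$ need only bound $n-1$; this lets the block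
      -- length be a ceiling.
      have hkb : (k : ℝ) ≤ b := by
        have : ((k + 1 : ℕ) : ℝ) ≤ n := by exact_mod_cast hk
        push_cast at this
        linarith
      have h8 : L * ∫ ω, ‖x t ω - x s ω‖ ∂μ ≤ Γ * (b * (ηx * Γ)) :=
        mul_le_mul hLΓ (h7.trans (by gcongr)) (integral_nonneg fun ω => norm_nonneg _) hΓ.le
      have h9 := mul_le_mul_of_nonneg_left (hr.sq_le t ht) (by positivity : 0 ≤ ηy ^ 2)
      have h10 := mul_le_mul_of_nonneg_left h6 (by positivity : 0 ≤ 2 * ηy)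
      have h11 := mul_le_mul_of_nonneg_left h8 (by positivity : 0 ≤ 4 * ηy)
      rw [Finset.sum_range_succ, ← add_assoc, ← htk]
      push_cast
      linarith
  refine le_of_forall_pos_le_add fun e he => ?_
  -- The total slack $n\delta$ stays below the arbitrary $e$.
  set δ := e / (n + 1) with hδ
  have hδ0 : 0 < δ := by positivity
  obtain ⟨v, hvm, hvY, hv⟩ := exists_measurable_almost_argmax hf hne hδ0
  have h1 := key δ hδ0 v hvm hvY hv n le_rfl
  have h2 : ∫ ω, ‖y s ω - v (x s ω)‖ ^ 2 ∂μ ≤ D ^ 2 := by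
    have hs : s ≤ T := by omega
    have h3 := integral_mono_of_nonneg (μ := μ) (ae_of_all _ fun ω => sq_nonneg ‖y s ω - v (x s ω)‖)
      (integrable_const (D ^ 2)) (ae_of_all _ fun ω => hD _ (hr.mem_y s hs ω) _ (hvY _))
    simpa using h3
  have h3 : 0 ≤ ∫ ω, ‖y (s + n) ω - v (x s ω)‖ ^ 2 ∂μ := integral_nonneg fun ω => sq_nonneg _
  have h4 : n * δ ≤ e := by
    rw [hδ, mul_div_assoc', div_le_iff₀ (by positivity)]
    nlinarith
  have h5 : D ^ 2 = 2 * ηy * (D ^ 2 / (2 * ηy)) := by field_simp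
  have h6 := mul_le_mul_of_nonneg_left h4 (by positivity : 0 ≤ 2 * ηy)
  refine le_of_mul_le_mul_left ?_ (by positivity : 0 < 2 * ηy)
  linarith

end IsNoisyRun

end Run

/-- The final, possibly shorter block is charged a full $c$, whence the $+1$. -/
theorem sum_range_le_of_blocks {a : ℕ → ℝ} {B T : ℕ} (hB : 0 < B) {c d : ℝ} (hc : 0 ≤ c)
    (h : ∀ s n, n ≤ B → s + n ≤ T → ∑ i ∈ Finset.range n, a (s + i) ≤ c + n * d) :
    ∑ i ∈ Finset.range T, a i ≤ (T / B + 1) * c + T * d := by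
  have hB' : (0 : ℝ) < B := by exact_mod_cast hB
  have key : ∀ k s, s + k ≤ T →
      ∑ i ∈ Finset.range k, a (s + i) ≤ ((k : ℝ) / B + 1) * c + k * d := by
    intro k
    induction k using Nat.strong_induction_on with
    | _ k ih =>
      intro s hs
      rcases le_or_gt k B with hk | hk
      · have h1 := h s k hk hs
        have h2 : 0 ≤ (k : ℝ) / B * c := by positivity
        linarith
      · obtain ⟨r, rfl⟩ := Nat.exists_eq_add_of_lt hk
        have h1 := h s B le_rfl (by omega)
        have h2 := ih (r + 1) (by omega) (s + B) (by omega)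
        rw [add_assoc, Finset.sum_range_add]
        simp only [← add_assoc] at h2 ⊢
        have h3 : ((B + r + 1 : ℕ) : ℝ) / B = 1 + ((r + 1 : ℕ) : ℝ) / B := by
          push_cast
          field_simp
          ring
        rw [h3]
        push_cast at h2 ⊢
        linarith
  simpa using key T 0 (by omega)

/-! ### Choice of the block length and the final estimate -/

section Run

variable {E F : Type*} [NormedAddCommGroup E] [InnerProductSpace ℝ E] [FiniteDimensional ℝ E]
  [MeasurableSpace E] [BorelSpace E]
  [NormedAddCommGroup F] [InnerProductSpace ℝ F] [FiniteDimensional ℝ F]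
  [MeasurableSpace F] [BorelSpace F]
  {Ω : Type*} [MeasurableSpace Ω] {μ : Measure Ω} [IsProbabilityMeasure μ]
  {f : E → F → ℝ} {Y : Set F} {L : ℝ≥0}
  {ρ D ηx ηy Γ ε c : ℝ} {x₀ : E} {T : ℕ} {x : ℕ → Ω → E} {y : ℕ → Ω → F}
  {g gm : ℕ → Ω → WithLp 2 (E × F)}

theorem IsNonconvexConcave.exists_isProx (hf : IsNonconvexConcave f Y L ρ D) (hne : Y.Nonempty)
    (hρ : 0 < ρ) (hb : BddBelow (range (primal f Y))) : ∃ p, IsProx (primal f Y) ρ p := by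
  obtain ⟨p, h1, h2, h3, h4⟩ := (hf.weaklyConvex_primal hne).exists_prox hρ
    (hf.lipschitz_primal hne).continuous hb
  exact ⟨p, h1, h2, h3, h4⟩

/-- The bound on the mean squared gradient of the Moreau envelope along a run. -/
theorem IsNoisyRun.sum_gradient_le (hr : IsNoisyRun μ f Y ηx ηy Γ x₀ T x y g gm)
    (hf : IsNonconvexConcave f Y L ρ D) (hne : Y.Nonempty) (hρ : 0 < ρ) (hD : 0 < D) (hε : 0 < ε)
    (hb : BddBelow (range (primal f Y))) (hΓ : 0 < Γ) (hLΓ : L ≤ Γ) (hc1 : 1 ≤ c) (hc2 : c ≤ 2)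
    (hηx : ηx = min (ε ^ 2 / (48 * ρ * Γ ^ 2)) (ε ^ 6 / (65536 * c * ρ ^ 3 * Γ ^ 4 * D ^ 2)))
    (hηy : ηy = ε ^ 2 / (16 * c * ρ * Γ ^ 2))
    (hT : 2 ^ 20 * (ρ * Γ ^ 2 * gap f Y x₀ / ε ^ 4 * max 1 (ρ ^ 2 * Γ ^ 2 * D ^ 2 / ε ^ 4))
      < T + 1) :
    ∑ t ∈ Finset.range (T + 1),
      ∫ ω, ‖gradient (moreauEnvelope (primal f Y) (1 / (2 * ρ))) (x t ω)‖ ^ 2 ∂μ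
      ≤ (T + 1) * ε ^ 2 := by
  obtain ⟨p, hp⟩ := hf.exists_isProx hne hρ hb
  simp only [hp.norm_gradient_sq, integral_const_mul]
  have hc0 : 0 < c := by linarith
  have hcard : ∀ u : ℕ → ℝ, (∀ t ≤ T, u t ≤ ε ^ 2) →
      ∑ t ∈ Finset.range (T + 1), u t ≤ (T + 1) * ε ^ 2 := by
    intro u hu
    have h1 := Finset.sum_le_card_nsmul (Finset.range (T + 1)) u (ε ^ 2) fun t ht =>
      hu t (Nat.lt_succ_iff.1 (Finset.mem_range.1 ht))
    simpa using h1
  have hq : ∀ t ≤ T, Integrable (fun ω => ‖p (x t ω) - x t ω‖ ^ 2) μ := fun t ht =>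
    hr.integrable_norm_prox_sub_sq hf hne hρ hp ht
  -- If $2\Gamma\le\epsilon$, every point is $\epsilon$-stationary, since the envelope gradient is
  -- at most $2L\le2\Gamma$. Otherwise $\epsilon^2<4\Gamma^2$ is available below.
  rcases le_or_gt (4 * Γ ^ 2) (ε ^ 2) with hcase | hcase
  · refine hcard _ fun t ht => ?_
    have h1 : ∫ ω, ‖p (x t ω) - x t ω‖ ^ 2 ∂μ ≤ ∫ _, (Γ / ρ) ^ 2 ∂μ := by
      refine integral_mono (hq t ht) (integrable_const _) fun ω => ?_
      refine pow_le_pow_left₀ (norm_nonneg _) ?_ 2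
      rw [le_div_iff₀ hρ, mul_comm]
      exact (hp.mul_norm_sub_le (hf.lipschitz_primal hne) hρ _).trans hLΓ
    simp only [integral_const, probReal_univ, one_smul] at h1
    calc 4 * ρ ^ 2 * ∫ ω, ‖p (x t ω) - x t ω‖ ^ 2 ∂μ ≤ 4 * ρ ^ 2 * (Γ / ρ) ^ 2 := by gcongr
      _ = 4 * Γ ^ 2 := by field_simp
      _ ≤ ε ^ 2 := hcase
  set κ := ρ ^ 2 * Γ ^ 2 * D ^ 2 / ε ^ 4 with hκ
  have hκ0 : 0 < κ := by positivity
  set M := max 1 κ with hM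
  have hM1 : 1 ≤ M := le_max_left _ _
  have hMκ : κ ≤ M := le_max_right _ _
  set Δ := gap f Y x₀ with hΔ
  have hΔ0 : 0 ≤ Δ := sub_nonneg.2 (ciInf_le hb x₀)
  have hη0 : 0 < ηx := by rw [hηx]; positivity
  have hηy0 : 0 < ηy := by rw [hηy]; positivity
  have hP : ρ * Γ ^ 2 * ηx ≤ ε ^ 2 / 48 := by
    have h1 : ηx ≤ ε ^ 2 / (48 * ρ * Γ ^ 2) := hηx ▸ min_le_left _ _
    calc ρ * Γ ^ 2 * ηx ≤ ρ * Γ ^ 2 * (ε ^ 2 / (48 * ρ * Γ ^ 2)) := by gcongr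
      _ = ε ^ 2 / 48 := by field_simp
  have hQ : ρ * Γ ^ 2 * ηx * (c * κ) ≤ ε ^ 2 / 65536 := by
    have h1 : ηx ≤ ε ^ 6 / (65536 * c * ρ ^ 3 * Γ ^ 4 * D ^ 2) := hηx ▸ min_le_right _ _
    calc ρ * Γ ^ 2 * ηx * (c * κ)
        ≤ ρ * Γ ^ 2 * (ε ^ 6 / (65536 * c * ρ ^ 3 * Γ ^ 4 * D ^ 2)) * (c * κ) := by gcongr
      _ = ε ^ 2 / 65536 := by rw [hκ]; field_simp
  -- A lower bound for $\eta_x$ covering both branches of the minimum; $131072=65536\cdot2$ because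
  -- $c\le2$.
  have hR : ε ^ 2 ≤ 131072 * (ρ * Γ ^ 2 * ηx * M) := by
    have h1 : ε ^ 2 / (131072 * (ρ * Γ ^ 2 * M)) ≤ ηx := by
      rw [hηx]
      refine le_min ?_ ?_
      · refine div_le_div_of_nonneg_left (by positivity) (by positivity) ?_
        have : ρ * Γ ^ 2 * 1 ≤ ρ * Γ ^ 2 * M := by gcongr
        have h3 : 0 < ρ * Γ ^ 2 := by positivity
        linarith
      · have h2 : ε ^ 6 / (65536 * c * ρ ^ 3 * Γ ^ 4 * D ^ 2)
            = ε ^ 2 / (65536 * c * (ρ * Γ ^ 2 * κ)) := by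
          rw [hκ]
          field_simp
        rw [h2]
        refine div_le_div_of_nonneg_left (by positivity) (by positivity) ?_
        have h3 : ρ * Γ ^ 2 * κ ≤ ρ * Γ ^ 2 * M := by gcongr
        have h4 : c * (ρ * Γ ^ 2 * κ) ≤ 2 * (ρ * Γ ^ 2 * M) := by gcongr
        linarith
    rw [div_le_iff₀ (by positivity)] at h1
    linarith
  have ha : ρ * Γ ^ 2 * Δ / ε ^ 4 * M = ρ * Γ ^ 2 * Δ * M / ε ^ 4 := by ring
  rw [ha, mul_div_assoc', div_lt_iff₀ (by positivity)] at hT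
  -- A block costs $4\rho D^2/(2\eta_y)=32c\kappa\epsilon^2$, hence at most $\epsilon^2/16$ per step
  -- of a full block.
  set B := ⌈512 * (c * κ)⌉₊ with hB
  have hB0 : 0 < B := Nat.ceil_pos.2 (by positivity)
  have hB1 : 512 * (c * κ) ≤ B := Nat.le_ceil _
  have hB2 : (B : ℝ) - 1 ≤ 512 * (c * κ) := by
    have := Nat.ceil_lt_add_one (by positivity : 0 ≤ 512 * (c * κ))
    linarith
  -- For a run shorter than a block, the lower bound on $T$ forces $\rho\Delta\le\epsilon^2/256$,
  -- and $\Phi(x_t)-\inf\Phi\le\Delta+L\|x_t-x_0\|$ bounds each gradient separately.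
  rcases lt_or_ge (T + 1) B with hTB | hTB
  · have hTB' : (T : ℝ) + 1 ≤ 512 * (c * κ) := by
      have : ((T + 1 + 1 : ℕ) : ℝ) ≤ B := by exact_mod_cast hTB
      push_cast at this
      linarith
    have hΔs : ρ * Δ ≤ ε ^ 2 / 256 := by
      have h1 : c * κ ≤ 2 * M := by gcongr
      have h2 : 2 ^ 20 * (ρ * Γ ^ 2 * Δ * M) ≤ 1024 * M * ε ^ 4 := by
        refine hT.le.trans ?_
        gcongr
        linarith
      have h3 : M * (1024 * (ρ * Δ) * (4 * Γ ^ 2)) ≤ M * (4 * (ε ^ 2 * ε ^ 2)) := by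
        linarith
      have h4 := le_of_mul_le_mul_left h3 (by linarith)
      have h5 : 1024 * (ρ * Δ) * ε ^ 2 ≤ 1024 * (ρ * Δ) * (4 * Γ ^ 2) := by gcongr
      have h6 : ε ^ 2 * (1024 * (ρ * Δ)) ≤ ε ^ 2 * (4 * ε ^ 2) := by linarith
      have := le_of_mul_le_mul_left h6 (by positivity)
      linarith
    refine hcard _ fun t ht => ?_
    have hd : Integrable (fun ω => ‖x t ω - x 0 ω‖) μ :=
      ((hr.integrable_x t ht).sub (hr.integrable_x 0 (Nat.zero_le _))).norm
    have h1 : ∫ ω, ρ * ‖p (x t ω) - x t ω‖ ^ 2 ∂μ ≤ ∫ ω, (Δ + L * ‖x t ω - x 0 ω‖) ∂μ := by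
      refine integral_mono ((hq t ht).const_mul ρ)
        ((integrable_const _).add (hd.const_mul _)) fun ω => ?_
      have h2 := hp.mul_norm_sub_sq_le hρ hb (x t ω)
      have h3 := hf.primal_sub_le hne (x t ω) (x 0 ω)
      dsimp only
      rw [hr.init_x] at h3 ⊢
      rw [hΔ, gap]
      linarith
    rw [integral_add (integrable_const _) (hd.const_mul _), integral_const_mul,
      integral_const_mul, integral_const] at h1
    simp only [probReal_univ, one_smul] at h1
    have h2 := hr.integral_norm_sub_le hΓ hη0.le 0 t (by omega)
    rw [zero_add] at h2
    have htT : (t : ℝ) ≤ 512 * (c * κ) := by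
      have : (t : ℝ) ≤ T := by exact_mod_cast ht
      linarith
    have h3 : L * ∫ ω, ‖x t ω - x 0 ω‖ ∂μ ≤ Γ * (512 * (c * κ) * (ηx * Γ)) :=
      mul_le_mul hLΓ (h2.trans (by gcongr)) (integral_nonneg fun ω => norm_nonneg _) hΓ.le
    have h4 := mul_le_mul_of_nonneg_left (h1.trans (add_le_add_right h3 Δ)) hρ.le
    nlinarith
  · have hTB' : (B : ℝ) ≤ T + 1 := by exact_mod_cast hTB
    have hB' : (0 : ℝ) < B := by exact_mod_cast hB0
    have hη2 : 2 * ρ * ηx ≤ 1 := by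
      have h1 : Γ ^ 2 * (2 * ρ * ηx) ≤ Γ ^ 2 * 1 := by
        linarith [sq_nonneg Γ]
      exact le_of_mul_le_mul_left h1 (by positivity)
    have hsum := hr.sum_norm_prox_sub_sq_le hf hne hρ hb hη0.le hη2 hp
    have hblock := sum_range_le_of_blocks (T := T)
      (a := fun t => ∫ ω, (primal f Y (x t ω) - f (x t ω) (y t ω)) ∂μ)
      (c := D ^ 2 / (2 * ηy)) (d := ηy * Γ ^ 2 / 2 + 2 * Γ ^ 2 * ηx * (512 * (c * κ))) hB0
      (by positivity) fun s n hn hs => hr.sum_gap_le hf hne hΓ hLΓ hη0.le hηy0 hs (by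
        have : (n : ℝ) ≤ B := by exact_mod_cast hn
        linarith)
    set S := ∑ t ∈ Finset.range T, ∫ ω, (primal f Y (x t ω) - f (x t ω) (y t ω)) ∂μ
    set Q := ∑ t ∈ Finset.range (T + 1), ∫ ω, ‖p (x t ω) - x t ω‖ ^ 2 ∂μ
    rw [← Finset.mul_sum]
    have e1 : 4 * ρ * (D ^ 2 / (2 * ηy)) = 32 * (c * κ) * ε ^ 2 := by
      rw [hηy, hκ]
      field_simp
      ring
    have e2 : 4 * ρ * (ηy * Γ ^ 2 / 2) ≤ ε ^ 2 / 8 := by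
      have : 4 * ρ * (ηy * Γ ^ 2 / 2) = ε ^ 2 / (8 * c) := by
        rw [hηy]
        field_simp
        ring
      rw [this]
      refine div_le_div_of_nonneg_left (by positivity) (by positivity) (by linarith)
    -- As $B\le T+1$, the incomplete block at most doubles the cost.
    have e3 : (T : ℝ) / B + 1 ≤ 2 * (T + 1) / B := by
      rw [le_div_iff₀ hB', add_mul, div_mul_cancel₀ _ hB'.ne']
      linarith
    have e4 : ((T : ℝ) / B + 1) * (32 * (c * κ) * ε ^ 2) ≤ (T + 1) * (ε ^ 2 / 8) := by
      calc ((T : ℝ) / B + 1) * (32 * (c * κ) * ε ^ 2)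
          ≤ (2 * (T + 1) / B) * (32 * (B / 512) * ε ^ 2) := by
            gcongr
            linarith
        _ = (T + 1) * (ε ^ 2 / 8) := by
            field_simp
            ring
    have e5 : 4 * ρ * S ≤ (T + 1) * (ε ^ 2 / 8) + T * (ε ^ 2 / 8 + ε ^ 2 / 16) := by
      have h1 := mul_le_mul_of_nonneg_left hblock (by positivity : 0 ≤ 4 * ρ)
      have h2 : 4 * ρ * (ηy * Γ ^ 2 / 2 + 2 * Γ ^ 2 * ηx * (512 * (c * κ)))
          ≤ ε ^ 2 / 8 + ε ^ 2 / 16 := by linarith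
      have h3 := mul_le_mul_of_nonneg_left h2 (Nat.cast_nonneg (α := ℝ) T)
      have h4 : ((T : ℝ) / B + 1) * (4 * ρ * (D ^ 2 / (2 * ηy))) ≤ (T + 1) * (ε ^ 2 / 8) := by
        rw [e1]
        exact e4
      linarith
    -- The constant $2^{20}=8\cdot131072$ of the iteration bound is fixed by this line and `hR`.
    have e6 : Δ ≤ ηx * ((T + 1) * (ε ^ 2 / 8)) := by
      have h1 : ρ * Γ ^ 2 * Δ * M * 2 ^ 20 * ε ^ 2
          ≤ (T + 1) * ε ^ 4 * (131072 * (ρ * Γ ^ 2 * ηx * M)) := by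
        refine mul_le_mul (by linarith) hR (by positivity) (by positivity)
      have h2 : (ρ * Γ ^ 2 * M * ε ^ 2) * Δ
          ≤ (ρ * Γ ^ 2 * M * ε ^ 2) * (ηx * ((T + 1) * (ε ^ 2 / 8))) := by linarith
      exact le_of_mul_le_mul_left h2 (by positivity)
    have hT0 : (0 : ℝ) ≤ T := Nat.cast_nonneg T
    have e7 : ηx * (4 * ρ ^ 2 * Q) ≤ ηx * ((T + 1) * (ε ^ 2 / 4) + 4 * ρ * S
        + 2 * T * (ρ * Γ ^ 2 * ηx)) := by linarith
    have e8 := le_of_mul_le_mul_left e7 hη0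
    have e9 := mul_le_mul_of_nonneg_left hP hT0
    have e10 : 0 ≤ T * ε ^ 2 := by positivity
    have e11 : 0 < ε ^ 2 := by positivity
    -- Per step and in units of $\epsilon^2$: $1/4$ from $\Delta$, $1/8$ from the blocks, $1/8+1/16$
    -- from ascent noise and drift, $1/24$ from descent noise; the sum is below $1$.
    linarith

end Run

/-! ### The uniformly drawn index -/

instance (T : ℕ) : IsProbabilityMeasure (uniformIndex T) := by
  unfold uniformIndex
  infer_instance

theorem integral_uniformIndex (T : ℕ) (u : ℕ → ℝ) :
    ∫ i, u i ∂uniformIndex T = ((T : ℝ) + 1)⁻¹ * ∑ t ∈ Finset.range (T + 1), u t := by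
  rw [uniformIndex, PMF.integral_eq_sum, Finset.sum_range, Finset.mul_sum]
  refine Finset.sum_congr rfl fun i _ => ?_
  rw [PMF.uniformOfFintype_apply, Fintype.card_fin, ENNReal.toReal_inv, ENNReal.toReal_natCast]
  push_cast
  rfl

theorem integrable_prod_uniformIndex {Ω : Type*} [MeasurableSpace Ω] {μ : Measure Ω}
    [IsProbabilityMeasure μ] {T : ℕ} {u : ℕ → Ω → ℝ} (hm : ∀ t ≤ T, Measurable (u t))
    (hi : ∀ t ≤ T, Integrable (u t) μ) :
    Integrable (fun s : Ω × Fin (T + 1) => u s.2 s.1) (μ.prod (uniformIndex T)) := by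
  have hmeas : Measurable fun s : Ω × Fin (T + 1) => u s.2 s.1 :=
    measurable_from_prod_countable_left fun i => hm i (Nat.lt_succ_iff.1 i.2)
  rw [integrable_prod_iff' hmeas.aestronglyMeasurable]
  exact ⟨ae_of_all _ fun i => hi i (Nat.lt_succ_iff.1 i.2), Integrable.of_finite⟩

/-! ### Moments and means with a fresh sample -/

section Independence

variable {Ω S Ξ K : Type*} [MeasurableSpace Ω] [MeasurableSpace S] [MeasurableSpace Ξ]
  [NormedAddCommGroup K] [InnerProductSpace ℝ K] [CompleteSpace K] [SecondCountableTopology K]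
  [MeasurableSpace K] [BorelSpace K]
  {μ : Measure Ω} [IsProbabilityMeasure μ] {ν : Measure Ξ} [IsProbabilityMeasure ν]
  {W : Ω → S} {ζ : Ω → Ξ} {A : Set S} {G : S × Ξ → K} {C : ℝ}

theorem map_prodMk_eq_of_indepFun (hW : Measurable W) (hζ : Measurable ζ) (hmap : μ.map ζ = ν)
    (hind : IndepFun W ζ μ) : μ.map (fun ω => (W ω, ζ ω)) = (μ.map W).prod ν := by
  rw [← hmap]
  exact (indepFun_iff_map_prod_eq_prod_map_map hW.aemeasurable hζ.aemeasurable).1 hind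

theorem memLp_two_prod {P : Measure S} [IsProbabilityMeasure P] (hP : ∀ᵐ w ∂P, w ∈ A)
    (hG : Measurable G) (hG2 : ∀ w ∈ A, MemLp (fun s => G (w, s)) 2 ν)
    (hC : ∀ w ∈ A, ∫ s, ‖G (w, s)‖ ^ 2 ∂ν ≤ C) : MemLp G 2 (P.prod ν) := by
  rw [memLp_two_iff_integrable_sq_norm hG.aestronglyMeasurable]
  have hm : Measurable fun q => ‖G q‖ ^ 2 := hG.norm.pow_const 2
  rw [integrable_prod_iff hm.aestronglyMeasurable]
  refine ⟨?_, ?_⟩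
  · filter_upwards [hP] with w hw
    exact (hG2 w hw).integrable_norm_pow two_ne_zero
  · refine (integrable_const C).mono'
      (hm.norm.stronglyMeasurable.integral_prod_right').aestronglyMeasurable ?_
    filter_upwards [hP] with w hw
    rw [Real.norm_of_nonneg (integral_nonneg fun s => norm_nonneg _)]
    simpa using hC w hw

theorem memLp_two_comp_of_indepFun (hW : Measurable W) (hζ : Measurable ζ) (hmap : μ.map ζ = ν)
    (hind : IndepFun W ζ μ) (hA : MeasurableSet A) (hWA : ∀ ω, W ω ∈ A) (hG : Measurable G)
    (hG2 : ∀ w ∈ A, MemLp (fun s => G (w, s)) 2 ν)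
    (hC : ∀ w ∈ A, ∫ s, ‖G (w, s)‖ ^ 2 ∂ν ≤ C) : MemLp (fun ω => G (W ω, ζ ω)) 2 μ := by
  have : IsProbabilityMeasure (μ.map W) := Measure.isProbabilityMeasure_map hW.aemeasurable
  have hP : ∀ᵐ w ∂μ.map W, w ∈ A := (ae_map_iff hW.aemeasurable hA).2 (ae_of_all _ hWA)
  have h1 := memLp_two_prod hP hG hG2 hC
  rw [← map_prodMk_eq_of_indepFun hW hζ hmap hind] at h1
  exact h1.comp_of_map (hW.prodMk hζ).aemeasurable

theorem integral_norm_sq_le_of_indepFun (hW : Measurable W) (hζ : Measurable ζ)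
    (hmap : μ.map ζ = ν) (hind : IndepFun W ζ μ) (hA : MeasurableSet A) (hWA : ∀ ω, W ω ∈ A)
    (hG : Measurable G) (hG2 : ∀ w ∈ A, MemLp (fun s => G (w, s)) 2 ν)
    (hC : ∀ w ∈ A, ∫ s, ‖G (w, s)‖ ^ 2 ∂ν ≤ C) : ∫ ω, ‖G (W ω, ζ ω)‖ ^ 2 ∂μ ≤ C := by
  have : IsProbabilityMeasure (μ.map W) := Measure.isProbabilityMeasure_map hW.aemeasurable
  have hP : ∀ᵐ w ∂μ.map W, w ∈ A := (ae_map_iff hW.aemeasurable hA).2 (ae_of_all _ hWA)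
  have hi := (memLp_two_prod hP hG hG2 hC).integrable_norm_pow two_ne_zero
  have h1 := integral_map (hW.prodMk hζ).aemeasurable
    (hG.norm.pow_const 2).aestronglyMeasurable (μ := μ)
  rw [← h1, map_prodMk_eq_of_indepFun hW hζ hmap hind, integral_prod _ hi]
  have h2 : ∫ w, ∫ s, ‖G (w, s)‖ ^ 2 ∂ν ∂μ.map W ≤ ∫ _, C ∂μ.map W := by
    refine integral_mono_ae hi.integral_prod_left (integrable_const _) ?_
    filter_upwards [hP] with w hw
    exact hC w hw
  simpa using h2

/-- Independence makes the joint law a product, so the fresh sample can be integrated out first. The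
bounds hold only on $A$, which carries the law of `W`. -/
theorem integral_inner_of_indepFun (hW : Measurable W) (hζ : Measurable ζ)
    (hmap : μ.map ζ = ν) (hind : IndepFun W ζ μ) (hA : MeasurableSet A) (hWA : ∀ ω, W ω ∈ A)
    (hG : Measurable G) (hG2 : ∀ w ∈ A, MemLp (fun s => G (w, s)) 2 ν)
    (hC : ∀ w ∈ A, ∫ s, ‖G (w, s)‖ ^ 2 ∂ν ≤ C) {h : S → K} (hh : Measurable h) {c : ℝ}
    (hc : ∀ w ∈ A, ‖h w‖ ≤ c) :
    ∫ ω, (inner ℝ (G (W ω, ζ ω)) (h (W ω)) : ℝ) ∂μ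
      = ∫ ω, inner ℝ (∫ s, G (W ω, s) ∂ν) (h (W ω)) ∂μ := by
  have : IsProbabilityMeasure (μ.map W) := Measure.isProbabilityMeasure_map hW.aemeasurable
  have hP : ∀ᵐ w ∂μ.map W, w ∈ A := (ae_map_iff hW.aemeasurable hA).2 (ae_of_all _ hWA)
  have hi := memLp_two_prod hP hG hG2 hC
  have hinm : Measurable fun q : S × Ξ => (inner ℝ (G q) (h q.1) : ℝ) :=
    hG.inner (hh.comp measurable_fst)
  have hin : Integrable (fun q : S × Ξ => (inner ℝ (G q) (h q.1) : ℝ)) ((μ.map W).prod ν) := by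
    refine ((hi.integrable one_le_two).norm.mul_const c).mono' hinm.aestronglyMeasurable ?_
    have hP' : ∀ᵐ q ∂(μ.map W).prod ν, q.1 ∈ A := Measure.quasiMeasurePreserving_fst.ae hP
    filter_upwards [hP'] with q hq
    exact (norm_inner_le_norm _ _).trans (mul_le_mul_of_nonneg_left (hc _ hq) (norm_nonneg _))
  have hmean : Measurable fun w : S => ∫ s, G (w, s) ∂ν :=
    (hG.stronglyMeasurable.integral_prod_right').measurable
  have h1 := integral_map (hW.prodMk hζ).aemeasurable hinm.aestronglyMeasurable (μ := μ)
  have h2 := integral_map hW.aemeasurable (hmean.inner (𝕜 := ℝ) hh).aestronglyMeasurable (μ := μ)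
  rw [← h1, ← h2, map_prodMk_eq_of_indepFun hW hζ hmap hind, integral_prod _ hin]
  refine integral_congr_ae ?_
  filter_upwards [hP] with w hw
  have hi : Integrable (fun s => G (w, s)) ν := (hG2 w hw).integrable one_le_two
  simp_rw [real_inner_comm (h w)]
  exact integral_inner hi (h w)

end Independence

/-! ### Both methods as noisy runs -/

section Stochastic

variable {E F : Type*} [NormedAddCommGroup E] [InnerProductSpace ℝ E] [FiniteDimensional ℝ E]
  [MeasurableSpace E] [BorelSpace E]
  [NormedAddCommGroup F] [InnerProductSpace ℝ F] [FiniteDimensional ℝ F]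
  [MeasurableSpace F] [BorelSpace F]
  {f : E → F → ℝ} {Y : Set F} {L : ℝ≥0} {ρ D σ ηx ηy : ℝ} {x₀ : E} {y₀ : F}
  {Ξ : Type*} [MeasurableSpace Ξ] {ν : Measure Ξ} [IsProbabilityMeasure ν]
  {G : E → F → Ξ → WithLp 2 (E × F)}

/-- The second moment is the variance plus the squared mean, and the mean is a Clarke subgradient,
of norm at most $L$. -/
theorem IsOracle.integral_norm_sq_le (hG : IsOracle f Y ν σ G) (hf : LipschitzWith L (joint f))
    (x : E) {y : F} (hy : y ∈ Y) : ∫ s, ‖G x y s‖ ^ 2 ∂ν ≤ L ^ 2 + σ ^ 2 := by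
  set m := ∫ s, G x y s ∂ν with hm
  have hL := hG.memLp x y hy
  have hi : Integrable (G x y) ν := hL.integrable one_le_two
  have hd : Integrable (fun s => ‖G x y s - m‖ ^ 2) ν :=
    (hL.sub (memLp_const m)).integrable_norm_pow two_ne_zero
  have h2 : Integrable (fun s => 2 * inner ℝ m (G x y s)) ν := (hi.const_inner m).const_mul 2
  have h3 : Integrable (fun s => 2 * inner ℝ m (G x y s) - ‖m‖ ^ 2) ν :=
    h2.sub (integrable_const _)
  have h1 : ∫ s, ‖G x y s‖ ^ 2 ∂ν
      = ∫ s, (‖G x y s - m‖ ^ 2 + (2 * inner ℝ m (G x y s) - ‖m‖ ^ 2)) ∂ν := by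
    refine integral_congr_ae (ae_of_all _ fun s => ?_)
    dsimp only
    rw [norm_sub_sq_real, real_inner_comm]
    ring
  rw [h1, integral_add hd h3, integral_sub h2 (integrable_const _), integral_const_mul,
    integral_inner hi, ← hm, real_inner_self_eq_norm_sq, integral_const]
  simp only [probReal_univ, one_smul]
  have h4 := hG.variance_le x y hy
  rw [← hm] at h4
  have h5 : ‖m‖ ≤ L := norm_le_of_mem_clarkeSubdifferential hf (hG.unbiased x y hy)
  have h6 := pow_le_pow_left₀ (norm_nonneg _) h5 2
  linarith

variable {Ω : Type*} [MeasurableSpace Ω] {μ : Measure Ω} [IsProbabilityMeasure μ]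

theorem ttsgda_snd_mem (hne : Y.Nonempty) (hcl : IsClosed Y) (hco : Convex ℝ Y) (hy₀ : y₀ ∈ Y)
    {M : ℕ} {ηx ηy : ℕ → ℝ} (ξ : ℕ → Fin M → Ξ) : ∀ t, (ttsgda Y ηx ηy G x₀ y₀ ξ t).2 ∈ Y
  | 0 => hy₀
  | _ + 1 => (proj_spec hne hcl hco _).1

/-- The iterates depend measurably on the samples that have been used. -/
theorem measurable_ttsgda {Ω : Type*} {m : MeasurableSpace Ω}
    (hGm : Measurable fun p : (E × F) × Ξ => G p.1.1 p.1.2 p.2)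
    (hne : Y.Nonempty) (hcl : IsClosed Y) (hco : Convex ℝ Y) {M : ℕ} {ηx ηy : ℕ → ℝ}
    {ξ : ℕ → Fin M → Ω → Ξ} {t : ℕ} (hm : ∀ s < t, ∀ i, Measurable (ξ s i)) (s : ℕ) (hs : s ≤ t) :
    Measurable fun ω => ttsgda Y ηx ηy G x₀ y₀ (fun t i => ξ t i ω) s := by
  induction s with
  | zero => exact measurable_const
  | succ s ih =>
    have ih := ih (Nat.le_of_succ_le hs)
    set z := fun ω => ttsgda Y ηx ηy G x₀ y₀ (fun t i => ξ t i ω) s with hz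
    have hg : Measurable fun ω => miniBatch G (fun i => ξ s i ω) (z ω).1 (z ω).2 := by
      have h1 : Measurable fun ω => ∑ i, G (z ω).1 (z ω).2 (ξ s i ω) :=
        Finset.measurable_fun_sum _ fun i _ => hGm.comp (ih.prodMk (hm s hs i))
      exact h1.const_smul (1 / (M : ℝ))
    have hg1 : Measurable fun ω => (miniBatch G (fun i => ξ s i ω) (z ω).1 (z ω).2).fst :=
      (WithLp.prod_continuous_ofLp 2 E F).fst.measurable.comp hg
    have hg2 : Measurable fun ω => (miniBatch G (fun i => ξ s i ω) (z ω).1 (z ω).2).snd :=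
      (WithLp.prod_continuous_ofLp 2 E F).snd.measurable.comp hg
    have hp : Measurable (proj Y) := (lipschitz_proj hne hcl hco).continuous.measurable
    exact (ih.fst.sub (hg1.const_smul _)).prodMk (hp.comp (ih.snd.add (hg2.const_smul _)))

/-- The iterates up to time `t` are independent of the sample that is drawn at time `t`. -/
theorem indepFun_ttsgda (hGm : Measurable fun p : (E × F) × Ξ => G p.1.1 p.1.2 p.2)
    (hne : Y.Nonempty) (hcl : IsClosed Y) (hco : Convex ℝ Y) {M : ℕ} {ηx ηy : ℕ → ℝ}
    {ξ : ℕ → Fin M → Ω → Ξ} (hξ : ∀ t i, Measurable (ξ t i))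
    (hind : iIndepFun (fun p : ℕ × Fin M => ξ p.1 p.2) μ) {s t : ℕ} (hs : s ≤ t) (i : Fin M) :
    IndepFun (fun ω => ((ttsgda Y ηx ηy G x₀ y₀ (fun t i => ξ t i ω) t).1,
      (ttsgda Y ηx ηy G x₀ y₀ (fun t i => ξ t i ω) t).2,
      (ttsgda Y ηx ηy G x₀ y₀ (fun t i => ξ t i ω) s).1)) (ξ t i) μ := by
  -- The samples before time $t$ generate a $\sigma$-algebra independent of the one at $(t,i)$, and
  -- the iterates up to $t$ are measurable for the former.
  let P : Set (ℕ × Fin M) := {p | p.1 < t}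
  let m : ℕ × Fin M → MeasurableSpace Ω := fun p => MeasurableSpace.comap (ξ p.1 p.2) inferInstance
  have hle : ∀ (Q : Set (ℕ × Fin M)), ∀ p ∈ Q, m p ≤ ⨆ p ∈ Q, m p := fun Q p hp =>
    le_iSup₂_of_le (f := fun p (_ : p ∈ Q) => m p) p hp le_rfl
  have hm1 : ∀ p, m p ≤ ‹MeasurableSpace Ω› := fun p => (hξ p.1 p.2).comap_le
  have hm2 : iIndep m μ := hind.iIndep
  have hd : Disjoint P {(t, i)} := Set.disjoint_singleton_right.2 (lt_irrefl t)
  have h1 : Indep (⨆ p ∈ P, m p) (⨆ p ∈ ({(t, i)} : Set (ℕ × Fin M)), m p) μ :=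
    indep_iSup_of_disjoint hm1 hm2 hd
  have h2 : ∀ r < t, ∀ i, Measurable[⨆ p ∈ P, m p] (ξ r i) := fun r hr i =>
    measurable_iff_comap_le.2 (hle P (r, i) hr)
  have h3 := measurable_ttsgda (m := ⨆ p ∈ P, m p) (ηx := ηx) (ηy := ηy) (x₀ := x₀) (y₀ := y₀)
    hGm hne hcl hco h2
  refine indep_of_indep_of_le_left (indep_of_indep_of_le_right h1 (hle {(t, i)} (t, i) rfl)) ?_
  exact measurable_iff_comap_le.1
    ((h3 t le_rfl).fst.prodMk ((h3 t le_rfl).snd.prodMk (h3 s hs).fst))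

/-- Steps along oracle answers with fresh samples form a noisy run. -/
theorem IsOracle.isNoisyRun (hG : IsOracle f Y ν σ G) (hf : IsNonconvexConcave f Y L ρ D)
    {z : ℕ → Ω → E × F} {ζ : ℕ → Ω → Ξ} (hz0 : ∀ ω, z 0 ω = (x₀, y₀))
    (hzm : ∀ t, Measurable (z t)) (hzY : ∀ t ω, (z t ω).2 ∈ Y) (hζ : ∀ t, Measurable (ζ t))
    (hmap : ∀ t, μ.map (ζ t) = ν)
    (hzi : ∀ t, ∀ s ≤ t, IndepFun (fun ω => ((z t ω).1, (z t ω).2, (z s ω).1)) (ζ t) μ)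
    (hstep : ∀ t ω, z (t + 1) ω = ((z t ω).1 - ηx • (G (z t ω).1 (z t ω).2 (ζ t ω)).fst,
      proj Y ((z t ω).2 + ηy • (G (z t ω).1 (z t ω).2 (ζ t ω)).snd))) (T : ℕ) :
    IsNoisyRun μ f Y ηx ηy (Real.sqrt (L ^ 2 + σ ^ 2)) x₀ T (fun t ω => (z t ω).1)
      (fun t ω => (z t ω).2) (fun t ω => G (z t ω).1 (z t ω).2 (ζ t ω))
      (fun t ω => ∫ s, G (z t ω).1 (z t ω).2 s ∂ν) := by
  obtain ⟨G', hG'⟩ : ∃ G' : (E × F × E) × Ξ → WithLp 2 (E × F),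
      ∀ w s, G' (w, s) = G w.1 w.2.1 s := ⟨fun q => G q.1.1 q.1.2.1 q.2, fun _ _ => rfl⟩
  have hG'm : Measurable G' := by
    have h : G' = fun q : (E × F × E) × Ξ => G q.1.1 q.1.2.1 q.2 := funext fun q => hG' q.1 q.2
    rw [h]
    exact hG.measurable.comp
      ((measurable_fst.fst.prodMk measurable_fst.snd.fst).prodMk measurable_snd)
  let A : Set (E × F × E) := {w | w.2.1 ∈ Y}
  have hAm : MeasurableSet A := hf.closed.measurableSet.preimage measurable_snd.fst
  have hWm : ∀ t s, Measurable fun ω => ((z t ω).1, (z t ω).2, (z s ω).1) := fun t s =>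
    (hzm t).fst.prodMk ((hzm t).snd.prodMk (hzm s).fst)
  have hG2 : ∀ w ∈ A, MemLp (fun s => G' (w, s)) 2 ν := fun w hw => by
    simp only [hG']
    exact hG.memLp w.1 w.2.1 hw
  have hGC : ∀ w ∈ A, ∫ s, ‖G' (w, s)‖ ^ 2 ∂ν ≤ L ^ 2 + σ ^ 2 := fun w hw => by
    simp only [hG']
    exact hG.integral_norm_sq_le hf.lipschitz w.1 hw
  have hm : ∀ t, Measurable fun ω => ∫ s, G (z t ω).1 (z t ω).2 s ∂ν := fun t =>
    (hG.measurable.stronglyMeasurable.integral_prod_right' (ν := ν)).measurable.comp (hzm t)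
  have h1 : ∀ t, MemLp (fun ω => G (z t ω).1 (z t ω).2 (ζ t ω)) 2 μ := fun t => by
    have h := memLp_two_comp_of_indepFun (hWm t t) (hζ t) (hmap t) (hzi t t le_rfl) hAm (hzY t)
      hG'm hG2 hGC
    simpa only [hG'] using h
  have h2 : ∀ t, ∫ ω, ‖G (z t ω).1 (z t ω).2 (ζ t ω)‖ ^ 2 ∂μ ≤ L ^ 2 + σ ^ 2 := fun t => by
    have h := integral_norm_sq_le_of_indepFun (hWm t t) (hζ t) (hmap t) (hzi t t le_rfl) hAm
      (hzY t) hG'm hG2 hGC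
    simpa only [hG'] using h
  exact
    { init_x := fun ω => congrArg Prod.fst (hz0 ω)
      measurable_x := fun t _ => (hzm t).fst
      measurable_y := fun t _ => (hzm t).snd
      measurable_mean := fun t _ => hm t
      memLp := fun t _ => h1 t
      mem_y := fun t _ => hzY t
      step_x := fun t _ ω => congrArg Prod.fst (hstep t ω)
      step_y := fun t _ ω => congrArg Prod.snd (hstep t ω)
      mem_subdiff := fun t _ ω => hG.unbiased _ _ (hzY t ω)
      sq_le := fun t _ => by
        rw [Real.sq_sqrt (by positivity)]
        exact h2 t
      unbiased := fun t _ s hs h hh ⟨c, hc⟩ => by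
        have h3 := integral_inner_of_indepFun (hWm t s) (hζ t) (hmap t) (hzi t s hs) hAm (hzY t)
          hG'm hG2 hGC hh (fun w hw => hc w.1 w.2.1 hw w.2.2)
        simpa only [hG'] using h3 }

/-- Stochastic gradient descent ascent with batch size one is a noisy run. -/
theorem isNoisyRun_ttsgda (hf : IsNonconvexConcave f Y L ρ D) (hy₀ : y₀ ∈ Y)
    (hG : IsOracle f Y ν σ G) {ξ : ℕ → Fin 1 → Ω → Ξ} (hξ : ∀ t i, Measurable (ξ t i))
    (hmap : ∀ t i, μ.map (ξ t i) = ν) (hind : iIndepFun (fun p : ℕ × Fin 1 => ξ p.1 p.2) μ)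
    (T : ℕ) :
    IsNoisyRun μ f Y ηx ηy (Real.sqrt (L ^ 2 + σ ^ 2)) x₀ T
      (fun t ω => (ttsgda Y (fun _ => ηx) (fun _ => ηy) G x₀ y₀ (fun t i => ξ t i ω) t).1)
      (fun t ω => (ttsgda Y (fun _ => ηx) (fun _ => ηy) G x₀ y₀ (fun t i => ξ t i ω) t).2)
      (fun t ω => G (ttsgda Y (fun _ => ηx) (fun _ => ηy) G x₀ y₀ (fun t i => ξ t i ω) t).1
        (ttsgda Y (fun _ => ηx) (fun _ => ηy) G x₀ y₀ (fun t i => ξ t i ω) t).2 (ξ t 0 ω))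
      (fun t ω => ∫ s, G (ttsgda Y (fun _ => ηx) (fun _ => ηy) G x₀ y₀ (fun t i => ξ t i ω) t).1
        (ttsgda Y (fun _ => ηx) (fun _ => ηy) G x₀ y₀ (fun t i => ξ t i ω) t).2 s ∂ν) := by
  have hne : Y.Nonempty := ⟨y₀, hy₀⟩
  refine hG.isNoisyRun (y₀ := y₀) (ζ := fun t => ξ t 0)
    (z := fun t ω => ttsgda Y (fun _ => ηx) (fun _ => ηy) G x₀ y₀ (fun t i => ξ t i ω) t) hf
    (fun _ => rfl)
    (fun t => measurable_ttsgda hG.measurable hne hf.closed hf.convex (fun s _ i => hξ s i) t le_rfl)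
    (fun t ω => ttsgda_snd_mem hne hf.closed hf.convex hy₀ _ t) (fun t => hξ t 0)
    (fun t => hmap t 0)
    (fun t s hs => indepFun_ttsgda hG.measurable hne hf.closed hf.convex hξ hind hs 0)
    (fun t ω => ?_) T
  simp [ttsgda, miniBatch]

/-- A deterministic run is a noisy run without noise. -/
theorem IsTTGDARun.exists_isNoisyRun (hf : IsNonconvexConcave f Y L ρ D) (hy₀ : y₀ ∈ Y) {T : ℕ}
    {x : ℕ → E} {y : ℕ → F} (hr : IsTTGDARun f Y (fun _ => ηx) (fun _ => ηy) x₀ y₀ T x y) :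
    ∃ g, IsNoisyRun (Measure.dirac ()) f Y ηx ηy L x₀ T (fun t _ => x t) (fun t _ => y t) g g := by
  have hne : Y.Nonempty := ⟨y₀, hy₀⟩
  choose! g hg using hr.step
  refine ⟨fun t _ => g t, fun _ => hr.init_x, fun t _ => measurable_const,
    fun t _ => measurable_const, fun t _ => measurable_const, fun t _ => memLp_const _,
    fun t ht _ => ?_, fun t ht _ => (hg t ht).2.1, fun t ht _ => (hg t ht).2.2,
    fun t ht _ => (hg t ht).1, fun t ht => ?_, fun _ _ _ _ _ _ _ => rfl⟩
  · cases t with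
    | zero =>
      rw [hr.init_y]
      exact hy₀
    | succ t =>
      rw [(hg t ht).2.2]
      exact (proj_spec hne hf.closed hf.convex _).1
  · simp only [integral_const, probReal_univ, one_smul]
    exact pow_le_pow_left₀ (norm_nonneg _)
      (norm_le_of_mem_clarkeSubdifferential hf.lipschitz (hg t ht).1) 2

end Stochastic

end Minimax

/-! ### The complexity bounds -/

open Minimax
theorem mainTheorem2 :
    ∃ C : ℝ, 0 < C ∧
      ∀ (m n : ℕ) (f : EuclideanSpace ℝ (Fin m) → EuclideanSpace ℝ (Fin n) → ℝ)
        (Y : Set (EuclideanSpace ℝ (Fin n))) (L : ℝ≥0) (ρ D ε : ℝ)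
        (x₀ : EuclideanSpace ℝ (Fin m)) (y₀ : EuclideanSpace ℝ (Fin n)),
        0 < L → 0 < ρ → 0 < D → 0 < ε →
        IsNonconvexConcave f Y L ρ D → y₀ ∈ Y → BddBelow (Set.range (primal f Y)) →
        -- the deterministic method
        (∀ ηx ηy : ℝ,
          ηx = min (ε ^ 2 / (48 * ρ * L ^ 2)) (ε ^ 6 / (65536 * ρ ^ 3 * L ^ 4 * D ^ 2)) →
          ηy = ε ^ 2 / (16 * ρ * L ^ 2) →
          ∃ N : ℕ,
            (N : ℝ) ≤ C * (ρ * L ^ 2 * gap f Y x₀ / ε ^ 4 *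
              max 1 (ρ ^ 2 * L ^ 2 * D ^ 2 / ε ^ 4)) ∧
            ∀ T : ℕ, N ≤ ttgdaEvals T →
              ∀ (x : ℕ → EuclideanSpace ℝ (Fin m)) (y : ℕ → EuclideanSpace ℝ (Fin n)),
                IsTTGDARun f Y (fun _ => ηx) (fun _ => ηy) x₀ y₀ T x y →
                IsEpsStationaryInMean (uniformIndex T) (primal f Y) ρ ε
                  (fun i : Fin (T + 1) => x i) ∧
                ∃ t ≤ T, IsEpsStationary (primal f Y) ρ ε (x t)) ∧
        -- the stochastic method with batch size one
        (∀ σ ηx ηy : ℝ, 0 ≤ σ →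
          ηx = min (ε ^ 2 / (48 * ρ * (L ^ 2 + σ ^ 2)))
            (ε ^ 6 / (131072 * ρ ^ 3 * (L ^ 2 + σ ^ 2) ^ 2 * D ^ 2)) →
          ηy = ε ^ 2 / (32 * ρ * (L ^ 2 + σ ^ 2)) →
          ∃ N : ℕ,
            (N : ℝ) ≤ C * (ρ * (L ^ 2 + σ ^ 2) * gap f Y x₀ / ε ^ 4 *
              max 1 (ρ ^ 2 * (L ^ 2 + σ ^ 2) * D ^ 2 / ε ^ 4)) ∧
            ∀ (Ξ : Type*) [MeasurableSpace Ξ] (ν : Measure Ξ) [IsProbabilityMeasure ν]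
              (G : EuclideanSpace ℝ (Fin m) → EuclideanSpace ℝ (Fin n) → Ξ →
                WithLp 2 (EuclideanSpace ℝ (Fin m) × EuclideanSpace ℝ (Fin n)))
              (Ω : Type*) [MeasurableSpace Ω] (μ : Measure Ω) [IsProbabilityMeasure μ]
              (ξ : ℕ → Fin 1 → Ω → Ξ),
              IsOracle f Y ν σ G →
              (∀ t i, Measurable (ξ t i)) → (∀ t i, μ.map (ξ t i) = ν) →
              iIndepFun (fun p : ℕ × Fin 1 => ξ p.1 p.2) μ →
              ∀ T : ℕ, N ≤ ttsgdaEvals 1 T →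
                IsEpsStationaryInMean (μ.prod (uniformIndex T)) (primal f Y) ρ ε
                  (fun s : Ω × Fin (T + 1) =>
                    (ttsgda Y (fun _ => ηx) (fun _ => ηy) G x₀ y₀
                      (fun t i => ξ t i s.1) s.2).1)) := by
  refine ⟨2 ^ 20, by positivity, fun m n f Y L ρ D ε x₀ y₀ hL hρ hD hε hf hy₀ hb => ?_⟩
  have hne : Y.Nonempty := ⟨y₀, hy₀⟩
  obtain ⟨p, hp⟩ := hf.exists_isProx hne hρ hb
  have hL' : (0 : ℝ) < L := hL
  have hgap : 0 ≤ gap f Y x₀ := sub_nonneg.2 (ciInf_le hb x₀)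
  have hgc : Continuous fun z => ‖gradient (moreauEnvelope (primal f Y) (1 / (2 * ρ))) z‖ ^ 2 := by
    have := hp.continuous
    simp only [hp.norm_gradient_sq]
    fun_prop
  constructor
  · intro ηx ηy hηx hηy
    -- Rounding down keeps $N$ below the bound with no additive constant; $N\le T$ still puts the
    -- bound strictly below $T+1$, the number of iterates averaged.
    refine ⟨⌊2 ^ 20 * (ρ * L ^ 2 * gap f Y x₀ / ε ^ 4 * max 1 (ρ ^ 2 * L ^ 2 * D ^ 2 / ε ^ 4))⌋₊,
      Nat.floor_le (by positivity), fun T hT x y hr => ?_⟩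
    obtain ⟨g, hg⟩ := hr.exists_isNoisyRun hf hy₀
    have hT' := (Nat.floor_lt' (Nat.succ_ne_zero T)).1 (Nat.lt_succ_of_le hT)
    have hsum := hg.sum_gradient_le hf hne hρ hD hε hb hL' le_rfl (c := 1) le_rfl one_le_two
      (by rw [mul_one]; exact hηx) (by rw [mul_one]; exact hηy) (by exact_mod_cast hT')
    simp only [integral_const, probReal_univ, one_smul] at hsum
    refine ⟨⟨fun _ => hp.differentiableAt _, Integrable.of_finite, ?_⟩, ?_⟩
    · rw [integral_uniformIndex T
        (fun t => ‖gradient (moreauEnvelope (primal f Y) (1 / (2 * ρ))) (x t)‖ ^ 2),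
        inv_mul_le_iff₀ (by positivity)]
      exact hsum
    · obtain ⟨t, ht, hle⟩ := Finset.exists_le_of_sum_le (s := Finset.range (T + 1))
        (g := fun _ => ε ^ 2) ⟨0, by simp⟩ (hsum.trans_eq (by simp))
      exact ⟨t, Nat.lt_succ_iff.1 (Finset.mem_range.1 ht), hp.differentiableAt _,
        (sq_le_sq₀ (norm_nonneg _) hε.le).1 hle⟩
  · intro σ ηx ηy hσ hηx hηy
    refine ⟨⌊2 ^ 20 * (ρ * (L ^ 2 + σ ^ 2) * gap f Y x₀ / ε ^ 4 *
      max 1 (ρ ^ 2 * (L ^ 2 + σ ^ 2) * D ^ 2 / ε ^ 4))⌋₊, Nat.floor_le (by positivity), ?_⟩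
    intro Ξ _ ν _ G Ω _ μ _ ξ hG hξ hmap hind T hT
    rw [ttsgdaEvals, one_mul] at hT
    have hT' := (Nat.floor_lt' (Nat.succ_ne_zero T)).1 (Nat.lt_succ_of_le hT)
    have hr := isNoisyRun_ttsgda (ηx := ηx) (ηy := ηy) (x₀ := x₀) hf hy₀ hG hξ hmap hind T
    have hΓ2 : Real.sqrt (L ^ 2 + σ ^ 2) ^ 2 = L ^ 2 + σ ^ 2 := Real.sq_sqrt (by positivity)
    have hΓ4 : Real.sqrt (L ^ 2 + σ ^ 2) ^ 4 = (L ^ 2 + σ ^ 2) ^ 2 := by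
      rw [show (4 : ℕ) = 2 * 2 from rfl, pow_mul, hΓ2]
    -- The stochastic step sizes correspond to $c=2$, the deterministic ones to $c=1$.
    have hsum := hr.sum_gradient_le hf hne hρ hD hε hb (Real.sqrt_pos.2 (by positivity))
      (Real.le_sqrt_of_sq_le (by nlinarith [sq_nonneg σ])) one_le_two le_rfl
      (by rw [hηx, hΓ2, hΓ4]; norm_num) (by rw [hηy, hΓ2]; norm_num)
      (by rw [hΓ2]; exact_mod_cast hT')
    have hi : ∀ t ≤ T, Integrable (fun ω => ‖gradient (moreauEnvelope (primal f Y) (1 / (2 * ρ)))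
        (ttsgda Y (fun _ => ηx) (fun _ => ηy) G x₀ y₀ (fun t i => ξ t i ω) t).1‖ ^ 2) μ := by
      intro t ht
      simp only [hp.norm_gradient_sq]
      exact (hr.integrable_norm_prox_sub_sq hf hne hρ hp ht).const_mul _
    have hprod := integrable_prod_uniformIndex
      (u := fun t ω => ‖gradient (moreauEnvelope (primal f Y) (1 / (2 * ρ)))
        (ttsgda Y (fun _ => ηx) (fun _ => ηy) G x₀ y₀ (fun t i => ξ t i ω) t).1‖ ^ 2)
      (fun t ht => hgc.measurable.comp (hr.measurable_x t ht)) hi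
    refine ⟨fun _ => hp.differentiableAt _, hprod, ?_⟩
    rw [integral_prod_symm _ hprod]
    dsimp only
    rw [integral_uniformIndex T (fun t => ∫ ω, ‖gradient (moreauEnvelope (primal f Y)
      (1 / (2 * ρ))) (ttsgda Y (fun _ => ηx) (fun _ => ηy) G x₀ y₀ (fun t i => ξ t i ω) t).1‖ ^ 2 ∂μ),
      inv_mul_le_iff₀ (by positivity)]
    exact hsum
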